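/- For $k\ge 1$ let $\mathcal G_k$ be the space of groups marked by an ordered generating $k$-tuple, up to isomorphism respecting the markings, with the metric $$d(\Gamma,\Gamma')=\inf\{e^{-R} : R\in\mathbb N,\ \Gamma \text{ and } \Gamma' \text{ have the same relations of length at most } R\},$$ where a relation of a marked group is an element of the free group of rank $k$ that is trivial in it. Let $F$ be Thompson's group, that is, the group under composition ($(fg)(t)=f(g(t))$) of all orientation-preserving piecewise-linear homeomorphisms of $[0,1]$ with finitely many breakpoints, all at dyadic rationals, and with all slopes powers of $2$. Let $x_0,x_1\in F$ be its standard generators: $$x_0(t)=\begin{cases}t/2 & 0\le t\le \tfrac12\\ t-\tfrac14 & \tfrac12\le t\le\tfrac34\\ 2t-1 & \tfrac34\le t\le 1,\end{cases}\qquad x_1(t)=\begin{cases}t & 0\le t\le\tfrac12\\ \tfrac t2+\tfrac14 & \tfrac12\le t\le\tfrac34\\ t-\tfrac18 & \tfrac34\le t\le\tfrac78\\ 2t-1 & \tfrac78\le t\le 1.\end{cases}$$ Let $R_1=[ba^{-1},a^{-1}ba]$ and $R_2=[ba^{-1},a^{-2}ba^2]$, and for $n\in\mathbb N$ let $$G_n=\langle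 a,b,c \mid R_1,\ R_2,\ c^{-1}a^n\rangle .$$ Then for every $n$ the elements $x_0,x_1,x_0^n$ generate $F$ and the marked groups $(F,(x_0,x_1,x_0^n))$ and $(G_n,(a,b,c))$ are isomorphic, and the sequence $(G_n,(a,b,c))$ converges in $\mathcal G_3$, as $n\to\infty$, to $(G,(a,b,c))$, where $$G=\langle a,b,c \mid R_1,\ R_2,\ [c,a],\ [(a^{-j}ba^j)a^{-1},\ c^{-i}(a^{-k}ba^k)c^i]\ \text{ for all } i\ge 1,\ j\ge 0,\ k\ge 0\rangle .$$ -/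

import Mathlib

open Filter Topology unitInterval

/-! ## The space of marked groups -/

/-- A group together with an ordered `k`-tuple of elements that generates it. -/
structure MarkedGroup (k : ℕ) where
  carrier : Type
  [group : Group carrier]
  gen : Fin k → carrier
  closure_gen : Subgroup.closure (Set.range gen) = ⊤

attribute [instance] MarkedGroup.group

namespace MarkedGroup

/-- Isomorphism of marked groups: a group isomorphism matching the markings in order. -/
def Iso {k : ℕ} (X Y : MarkedGroup k) : Prop :=
  ∃ e : X.carrier ≃* Y.carrier, ∀ i, e (X.gen i) = Y.gen i

instance setoid (k : ℕ) : Setoid (MarkedGroup k) where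
  r := Iso
  iseqv :=
    { refl := fun X => ⟨MulEquiv.refl _, fun _ => rfl⟩
      symm := by
        rintro X Y ⟨e, he⟩
        exact ⟨e.symm, fun i => by rw [← he i, e.symm_apply_apply]⟩
      trans := by
        rintro X Y Z ⟨e, he⟩ ⟨f, hf⟩
        exact ⟨e.trans f, fun i => by simp [he, hf]⟩ }

/-- The canonical epimorphism from the free group of rank `k`. -/
def proj {k : ℕ} (X : MarkedGroup k) : FreeGroup (Fin k) →* X.carrier :=
  FreeGroup.lift X.gen

theorem proj_surjective {k : ℕ} (X : MarkedGroup k) : Function.Surjective X.proj := by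
  rw [← MonoidHom.range_eq_top, proj, FreeGroup.range_lift_eq_closure, X.closure_gen]

/-- The relations of a marked group: the words that are trivial in it. -/
def relations {k : ℕ} (X : MarkedGroup k) : Subgroup (FreeGroup (Fin k)) :=
  X.proj.ker

theorem relations_eq_of_iso {k : ℕ} {X Y : MarkedGroup k} (h : X.Iso Y) :
    X.relations = Y.relations := by
  obtain ⟨e, he⟩ := h
  have key : Y.proj = e.toMonoidHom.comp X.proj := by
    apply FreeGroup.ext_hom
    intro i
    simp [proj, he]
  ext w
  simp [relations, MonoidHom.mem_ker, key]

theorem iso_of_relations_eq {k : ℕ} {X Y : MarkedGroup k}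
    (h : X.relations = Y.relations) : X.Iso Y := by
  have h' : X.proj.ker = Y.proj.ker := h
  refine ⟨(QuotientGroup.quotientKerEquivOfSurjective _ X.proj_surjective).symm.trans
    ((QuotientGroup.quotientMulEquivOfEq h').trans
      (QuotientGroup.quotientKerEquivOfSurjective _ Y.proj_surjective)), fun i => ?_⟩
  have hx : X.gen i = QuotientGroup.quotientKerEquivOfSurjective _ X.proj_surjective
      (QuotientGroup.mk (FreeGroup.of i)) := by
    change X.gen i = X.proj (FreeGroup.of i)
    simp [proj]
  rw [hx]
  simp only [MulEquiv.trans_apply, MulEquiv.symm_apply_apply]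
  change Y.proj (FreeGroup.of i) = Y.gen i
  simp [proj]

end MarkedGroup

/-- The set `𝒢_k` of groups marked by `k` elements, up to isomorphism of marked groups. -/
def MarkedGroupSpace (k : ℕ) : Type 1 := Quotient (MarkedGroup.setoid k)

namespace MarkedGroupSpace

/-- The point of `𝒢_k` given by a generating `k`-tuple of a group. -/
def mk {k : ℕ} {G : Type} [Group G] (s : Fin k → G)
    (hs : Subgroup.closure (Set.range s) = ⊤) : MarkedGroupSpace k :=
  Quotient.mk (MarkedGroup.setoid k) { carrier := G, gen := s, closure_gen := hs }

def relations {k : ℕ} : MarkedGroupSpace k → Subgroup (FreeGroup (Fin k)) :=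
  Quotient.lift MarkedGroup.relations fun _ _ h => MarkedGroup.relations_eq_of_iso h

theorem ext_relations {k : ℕ} {x y : MarkedGroupSpace k} (h : x.relations = y.relations) :
    x = y := by
  induction x using Quotient.inductionOn
  induction y using Quotient.inductionOn
  exact Quotient.sound (MarkedGroup.iso_of_relations_eq h)

/-- Two marked groups have the same relations of length at most `R`. -/
def Agree {k : ℕ} (R : ℕ) (x y : MarkedGroupSpace k) : Prop :=
  ∀ w : FreeGroup (Fin k), w.norm ≤ R → (w ∈ x.relations ↔ w ∈ y.relations)

theorem Agree.symm {k R : ℕ} {x y : MarkedGroupSpace k} (h : Agree R x y) : Agree R y x :=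
  fun w hw => (h w hw).symm

/-- The distance is the least number that is at most `exp (-R)` for each `R` such that the two
marked groups have the same relations of length at most `R`. -/
noncomputable instance {k : ℕ} : Dist (MarkedGroupSpace k) where
  dist x y := sInf {r : ℝ | ∃ R : ℕ, Agree R x y ∧ r = Real.exp (-(R : ℝ))}

theorem dist_def {k : ℕ} (x y : MarkedGroupSpace k) :
    dist x y = sInf {r : ℝ | ∃ R : ℕ, Agree R x y ∧ r = Real.exp (-(R : ℝ))} := rfl

theorem bddBelow_aux {k : ℕ} (x y : MarkedGroupSpace k) :
    BddBelow {r : ℝ | ∃ R : ℕ, Agree R x y ∧ r = Real.exp (-(R : ℝ))} :=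
  ⟨0, by rintro r ⟨R, -, rfl⟩; positivity⟩

theorem nonempty_aux {k : ℕ} (x y : MarkedGroupSpace k) :
    {r : ℝ | ∃ R : ℕ, Agree R x y ∧ r = Real.exp (-(R : ℝ))}.Nonempty := by
  refine ⟨_, 0, fun w hw => ?_, rfl⟩
  rw [FreeGroup.norm_eq_zero.mp (Nat.le_zero.mp hw)]
  simp

theorem dist_le_of_agree {k R : ℕ} {x y : MarkedGroupSpace k} (h : Agree R x y) :
    dist x y ≤ Real.exp (-(R : ℝ)) :=
  csInf_le (bddBelow_aux x y) ⟨R, h, rfl⟩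

theorem agree_of_dist_lt {k R : ℕ} {x y : MarkedGroupSpace k}
    (h : dist x y < Real.exp (-(R : ℝ))) : Agree R x y := by
  obtain ⟨_, ⟨S, hS, rfl⟩, hlt⟩ := exists_lt_of_csInf_lt (nonempty_aux x y) h
  have hRS : R ≤ S := by
    have := Real.exp_lt_exp.mp hlt
    have : (R : ℝ) < S := by linarith
    exact_mod_cast this.le
  exact fun w hw => hS w (hw.trans hRS)

noncomputable instance {k : ℕ} : MetricSpace (MarkedGroupSpace k) where
  dist_self x := by
    apply le_antisymm
    · refine ge_of_tendsto' (x := atTop) (f := fun R : ℕ => Real.exp (-(R : ℝ))) ?_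
        fun R => dist_le_of_agree fun _ _ => Iff.rfl
      exact Real.tendsto_exp_neg_atTop_nhds_zero.comp tendsto_natCast_atTop_atTop
    · exact Real.sInf_nonneg (by rintro r ⟨R, -, rfl⟩; positivity)
  dist_comm x y := by
    rw [dist_def, dist_def]
    congr 1
    ext r
    exact ⟨fun ⟨R, h, e⟩ => ⟨R, h.symm, e⟩, fun ⟨R, h, e⟩ => ⟨R, h.symm, e⟩⟩
  dist_triangle x y z := by
    rw [← sub_le_iff_le_add]
    refine le_csInf (nonempty_aux x y) ?_
    rintro _ ⟨R, hR, rfl⟩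
    rw [sub_le_comm]
    refine le_csInf (nonempty_aux y z) ?_
    rintro _ ⟨S, hS, rfl⟩
    rw [sub_le_iff_le_add]
    rcases le_total R S with h | h
    · have := dist_le_of_agree (R := R) (x := x) (y := z)
        fun w hw => (hR w hw).trans (hS w (hw.trans h))
      have := Real.exp_pos (-(S : ℝ))
      linarith
    · have := dist_le_of_agree (R := S) (x := x) (y := z)
        fun w hw => (hR w (hw.trans h)).trans (hS w hw)
      have := Real.exp_pos (-(R : ℝ))
      linarith
  eq_of_dist_eq_zero {x y} h := by
    apply ext_relations
    ext w
    exact agree_of_dist_lt (R := w.norm) (by rw [h]; positivity) w le_rfl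

end MarkedGroupSpace

/-! ## Thompson's group `F` -/

def IsDyadic (x : ℝ) : Prop := ∃ (m : ℤ) (N : ℕ), x = m / 2 ^ N

theorem isDyadic_zero : IsDyadic 0 := ⟨0, 0, by simp⟩

theorem IsDyadic.add {x y : ℝ} (hx : IsDyadic x) (hy : IsDyadic y) : IsDyadic (x + y) := by
  obtain ⟨m, N, rfl⟩ := hx
  obtain ⟨m', N', rfl⟩ := hy
  refine ⟨m * 2 ^ N' + m' * 2 ^ N, N + N', ?_⟩
  push_cast
  rw [pow_add]
  field_simp

theorem IsDyadic.sub {x y : ℝ} (hx : IsDyadic x) (hy : IsDyadic y) : IsDyadic (x - y) := by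
  obtain ⟨m', N', rfl⟩ := hy
  rw [sub_eq_add_neg]
  exact hx.add ⟨-m', N', by push_cast; ring⟩

theorem IsDyadic.zpow_mul {x : ℝ} (hx : IsDyadic x) (k : ℤ) : IsDyadic (2 ^ k * x) := by
  obtain ⟨m, N, rfl⟩ := hx
  rcases Int.le_total 0 k with h | h
  · obtain ⟨n, rfl⟩ := Int.eq_ofNat_of_zero_le h
    exact ⟨2 ^ n * m, N, by push_cast; rw [zpow_natCast]; ring⟩
  · obtain ⟨n, hn⟩ := Int.eq_ofNat_of_zero_le (neg_nonneg.mpr h)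
    obtain rfl : k = -(n : ℤ) := by omega
    exact ⟨m, N + n, by rw [zpow_neg, zpow_natCast, pow_add]; field_simp⟩

/-- `f` is linear with slope a power of two on every interval `[x, y]` with no point of `B`
in its interior. -/
def LinearOff (f : I ≃ₜ I) (B : Finset I) : Prop :=
  ∀ x y : I, (∀ b ∈ B, b ∉ Set.Ioo x y) →
    ∃ k : ℤ, ∀ u ∈ Set.Icc x y, ∀ v ∈ Set.Icc x y,
      (f v : ℝ) - (f u : ℝ) = 2 ^ k * ((v : ℝ) - (u : ℝ))

/-- An orientation-preserving homeomorphism of `[0, 1]`, linear with slopes powers of two on the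
pieces cut out by finitely many breakpoints, all of them dyadic. -/
def IsThompson (f : I ≃ₜ I) : Prop :=
  StrictMono f ∧ ∃ B : Finset I, (∀ b ∈ B, IsDyadic b) ∧ LinearOff f B

theorem IsThompson.map_zero {f : I ≃ₜ I} (hf : IsThompson f) : f 0 = 0 := by
  apply le_antisymm _ unitInterval.nonneg'
  calc f 0 ≤ f (f.symm 0) := hf.1.monotone unitInterval.nonneg'
    _ = 0 := f.apply_symm_apply 0

theorem LinearOff.exists_base {f : I ≃ₜ I} {B : Finset I} (hB : ∀ b ∈ B, IsDyadic b)
    (h : LinearOff f B) {x : I} (hx : 0 < x) :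
    ∃ b : I, b < x ∧ (b = 0 ∨ b ∈ B) ∧ IsDyadic b ∧
      ∃ k : ℤ, (f x : ℝ) - f b = 2 ^ k * ((x : ℝ) - b) := by
  classical
  set S : Finset I := (insert 0 B).filter (· < x) with hS
  have hne : S.Nonempty := ⟨0, by simp [hS, hx]⟩
  have hm := S.max'_mem hne
  simp only [hS, Finset.mem_filter, Finset.mem_insert] at hm
  refine ⟨S.max' hne, hm.2, hm.1, ?_, ?_⟩
  · rcases hm.1 with h0 | h0
    · simp only [hS] at *
      rw [h0]
      simpa using isDyadic_zero
    · exact hB _ h0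
  · obtain ⟨k, hk⟩ := h (S.max' hne) x (by
      rintro b hb ⟨h1, h2⟩
      exact absurd (S.le_max' b (by simp [hS, hb, h2])) (not_le.mpr h1))
    exact ⟨k, hk _ ⟨le_rfl, hm.2.le⟩ _ ⟨hm.2.le, le_rfl⟩⟩

theorem IsThompson.isDyadic_iff {f : I ≃ₜ I} (hf : IsThompson f) (x : I) :
    IsDyadic (f x) ↔ IsDyadic x := by
  obtain ⟨-, B, hB, hlin⟩ := id hf
  have base : ∀ b : I, (b = 0 ∨ b ∈ B) → IsDyadic (f b) := by
    have hwf : ∀ n : ℕ, ∀ b : I, (B.filter (· < b)).card = n → (b = 0 ∨ b ∈ B) →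
        IsDyadic (f b) := by
      intro n
      induction n using Nat.strong_induction_on with
      | _ n ih =>
        intro b hn hb
        rcases eq_or_lt_of_le (unitInterval.nonneg' : (0 : I) ≤ b) with h0 | h0
        · rw [← h0, hf.map_zero]
          simpa using isDyadic_zero
        · obtain ⟨c, hcb, hc, hcd, k, hk⟩ := hlin.exists_base hB h0
          have hbd : IsDyadic b := by
            rcases hb with rfl | hb
            · simpa using isDyadic_zero
            · exact hB b hb
          have hfc : IsDyadic (f c) := by
            rcases hc with rfl | hc
            · rw [hf.map_zero]
              simpa using isDyadic_zero
            · refine ih _ ?_ c rfl (Or.inr hc)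
              rw [← hn]
              apply Finset.card_lt_card
              refine Finset.ssubset_iff_of_subset (fun d hd => ?_) |>.mpr
                ⟨c, by simp [hc, hcb], by simp⟩
              simp only [Finset.mem_filter] at hd ⊢
              exact ⟨hd.1, hd.2.trans hcb⟩
          rw [show (f b : ℝ) = f c + 2 ^ k * ((b : ℝ) - c) by linarith]
          exact hfc.add ((hbd.sub hcd).zpow_mul k)
    exact fun b => hwf _ b rfl
  rcases eq_or_lt_of_le (unitInterval.nonneg' : (0 : I) ≤ x) with h0 | h0
  · rw [← h0, hf.map_zero]
  · obtain ⟨c, -, hc, hcd, k, hk⟩ := hlin.exists_base hB h0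
    constructor
    · intro h
      have h2 : (2 : ℝ) ^ (-k) * 2 ^ k = 1 := by
        rw [← zpow_add₀ (by norm_num)]
        simp
      rw [show (x : ℝ) = c + 2 ^ (-k) * ((f x : ℝ) - f c) by
        rw [hk, ← mul_assoc, h2]; ring]
      exact hcd.add ((h.sub (base c hc)).zpow_mul _)
    · intro h
      rw [show (f x : ℝ) = f c + 2 ^ k * ((x : ℝ) - c) by linarith]
      exact (base c hc).add ((h.sub hcd).zpow_mul k)

/-- Thompson's group `F`, under composition: `(f * g) x = f (g x)`. -/
def ThompsonF : Subgroup (I ≃ₜ I) where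
  carrier := {f | IsThompson f}
  one_mem' := ⟨strictMono_id, ∅, by simp, fun x y _ => ⟨0, by simp⟩⟩
  mul_mem' := by
    classical
    rintro f g hf hg
    refine ⟨hf.1.comp hg.1, ?_⟩
    obtain ⟨hfm, B, hB, hf'⟩ := id hf
    obtain ⟨hgm, C, hC, hg'⟩ := id hg
    refine ⟨C ∪ B.image g.symm, ?_, ?_⟩
    · intro b hb
      rcases Finset.mem_union.mp hb with hb | hb
      · exact hC b hb
      · obtain ⟨c, hc, rfl⟩ := Finset.mem_image.mp hb
        rw [← hg.isDyadic_iff, g.apply_symm_apply]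
        exact hB c hc
    · intro x y hxy
      obtain ⟨k, hk⟩ := hg' x y fun b hb => hxy b (Finset.mem_union_left _ hb)
      obtain ⟨l, hl⟩ := hf' (g x) (g y) fun b hb hbm =>
        hxy (g.symm b) (Finset.mem_union_right _ (Finset.mem_image_of_mem _ hb))
          ⟨hgm.lt_iff_lt.mp (by rw [g.apply_symm_apply]; exact hbm.1),
            hgm.lt_iff_lt.mp (by rw [g.apply_symm_apply]; exact hbm.2)⟩
      refine ⟨l + k, fun u hu v hv => ?_⟩
      have := hl (g u) ⟨hgm.monotone hu.1, hgm.monotone hu.2⟩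
        (g v) ⟨hgm.monotone hv.1, hgm.monotone hv.2⟩
      rw [hk u hu v hv] at this
      rw [zpow_add₀ (by norm_num), mul_assoc]
      exact this
  inv_mem' := by
    classical
    intro f hf
    obtain ⟨hfm, B, hB, hf'⟩ := id hf
    have hsm : StrictMono f.symm := fun x y hxy =>
      hfm.lt_iff_lt.mp (by simpa using hxy)
    refine ⟨hsm, B.image f, ?_, ?_⟩
    · intro b hb
      obtain ⟨c, hc, rfl⟩ := Finset.mem_image.mp hb
      exact (hf.isDyadic_iff c).mpr (hB c hc)
    · intro x y hxy
      obtain ⟨k, hk⟩ := hf' (f.symm x) (f.symm y) fun b hb hbm =>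
        hxy (f b) (Finset.mem_image_of_mem _ hb)
          ⟨by simpa using hfm hbm.1, by simpa using hfm hbm.2⟩
      refine ⟨-k, fun u hu v hv => ?_⟩
      have h := hk (f.symm u) ⟨hsm.monotone hu.1, hsm.monotone hu.2⟩
        (f.symm v) ⟨hsm.monotone hv.1, hsm.monotone hv.2⟩
      rw [f.apply_symm_apply, f.apply_symm_apply] at h
      have h2 : (2 : ℝ) ^ (-k) * 2 ^ k = 1 := by
        rw [← zpow_add₀ (by norm_num)]
        simp
      change (f.symm v : ℝ) - (f.symm u : ℝ) = _
      rw [h, ← mul_assoc, h2, one_mul]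

namespace ThompsonF

theorem isThompson_of_steps (f : I ≃ₜ I) (p q r : I) (i j k l : ℤ)
    (hp : IsDyadic p) (hq : IsDyadic q) (hr : IsDyadic r) (hf : StrictMono f)
    (h₁ : ∀ u v : I, u ≤ p → v ≤ p → (f v : ℝ) - f u = 2 ^ i * ((v : ℝ) - u))
    (h₂ : ∀ u v : I, p ≤ u → u ≤ q → p ≤ v → v ≤ q → (f v : ℝ) - f u = 2 ^ j * ((v : ℝ) - u))
    (h₃ : ∀ u v : I, q ≤ u → u ≤ r → q ≤ v → v ≤ r → (f v : ℝ) - f u = 2 ^ k * ((v : ℝ) - u))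
    (h₄ : ∀ u v : I, r ≤ u → r ≤ v → (f v : ℝ) - f u = 2 ^ l * ((v : ℝ) - u)) :
    IsThompson f := by
  classical
  refine ⟨hf, {p, q, r}, by simp [hp, hq, hr], fun x y hxy => ?_⟩
  simp only [Finset.mem_insert, Finset.mem_singleton, forall_eq_or_imp, forall_eq,
    Set.mem_Ioo, not_and_or, not_lt] at hxy
  obtain ⟨hxp, hxq, hxr⟩ := hxy
  rcases hxp.symm with hxp | hxp
  · exact ⟨i, fun u hu v hv => h₁ u v (hu.2.trans hxp) (hv.2.trans hxp)⟩
  rcases hxq.symm with hxq | hxq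
  · exact ⟨j, fun u hu v hv => h₂ u v (hxp.trans hu.1) (hu.2.trans hxq)
      (hxp.trans hv.1) (hv.2.trans hxq)⟩
  rcases hxr.symm with hxr | hxr
  · exact ⟨k, fun u hu v hv => h₃ u v (hxq.trans hu.1) (hu.2.trans hxr)
      (hxq.trans hv.1) (hv.2.trans hxr)⟩
  · exact ⟨l, fun u hu v hv => h₄ u v (hxr.trans hu.1) (hxr.trans hv.1)⟩

/-- The map `t ↦ t / 2` on `[0, 1/2]`, `t ↦ t - 1/4` on `[1/2, 3/4]`, `t ↦ 2 t - 1` on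
`[3/4, 1]`. -/
noncomputable def map₀ (t : ℝ) : ℝ :=
  if t ≤ 1 / 2 then t / 2 else if t ≤ 3 / 4 then t - 1 / 4 else 2 * t - 1

/-- The inverse of `map₀`. -/
noncomputable def inv₀ (t : ℝ) : ℝ :=
  if t ≤ 1 / 4 then 2 * t else if t ≤ 1 / 2 then t + 1 / 4 else (t + 1) / 2

/-- The identity on `[0, 1/2]`, and the map `t ↦ t / 2 + 1 / 4` on `[1/2, 3/4]`,
`t ↦ t - 1/8` on `[3/4, 7/8]`, `t ↦ 2 t - 1` on `[7/8, 1]`. -/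
noncomputable def map₁ (t : ℝ) : ℝ :=
  if t ≤ 1 / 2 then t else if t ≤ 3 / 4 then t / 2 + 1 / 4
    else if t ≤ 7 / 8 then t - 1 / 8 else 2 * t - 1

/-- The inverse of `map₁`. -/
noncomputable def inv₁ (t : ℝ) : ℝ :=
  if t ≤ 1 / 2 then t else if t ≤ 5 / 8 then 2 * t - 1 / 2
    else if t ≤ 3 / 4 then t + 1 / 8 else (t + 1) / 2

theorem strictMono_map₀ : StrictMono map₀ := by
  intro s t h
  unfold map₀
  split_ifs <;> linarith

theorem strictMono_map₁ : StrictMono map₁ := by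
  intro s t h
  unfold map₁
  split_ifs <;> linarith

/-- The homeomorphism of `[0, 1]` with underlying function `map₀`. -/
noncomputable def homeo₀ : I ≃ₜ I :=
  (StrictMono.orderIsoOfRightInverse
    (fun t : I => (⟨map₀ t, by
      have := t.2.1; have := t.2.2; constructor <;> (unfold map₀; split_ifs <;> linarith)⟩ : I))
    (fun s t h => strictMono_map₀ (Subtype.coe_lt_coe.mpr h))
    (fun t : I => (⟨inv₀ t, by
      have := t.2.1; have := t.2.2; constructor <;> (unfold inv₀; split_ifs <;> linarith)⟩ : I))
    (fun t => Subtype.ext (by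
      change map₀ (inv₀ t) = t
      unfold map₀ inv₀
      split_ifs <;> linarith))).toHomeomorph

/-- The homeomorphism of `[0, 1]` with underlying function `map₁`. -/
noncomputable def homeo₁ : I ≃ₜ I :=
  (StrictMono.orderIsoOfRightInverse
    (fun t : I => (⟨map₁ t, by
      have := t.2.1; have := t.2.2; constructor <;> (unfold map₁; split_ifs <;> linarith)⟩ : I))
    (fun s t h => strictMono_map₁ (Subtype.coe_lt_coe.mpr h))
    (fun t : I => (⟨inv₁ t, by
      have := t.2.1; have := t.2.2; constructor <;> (unfold inv₁; split_ifs <;> linarith)⟩ : I))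
    (fun t => Subtype.ext (by
      change map₁ (inv₁ t) = t
      unfold map₁ inv₁
      split_ifs <;> linarith))).toHomeomorph

theorem coe_homeo₀ (t : I) : (homeo₀ t : ℝ) = map₀ t := rfl

theorem coe_homeo₁ (t : I) : (homeo₁ t : ℝ) = map₁ t := rfl

theorem isThompson₀ : IsThompson homeo₀ := by
  refine isThompson_of_steps homeo₀ ⟨1 / 2, by norm_num, by norm_num⟩
    ⟨3 / 4, by norm_num, by norm_num⟩ ⟨3 / 4, by norm_num, by norm_num⟩ (-1) 0 1 1
    ⟨1, 1, by norm_num⟩ ⟨3, 2, by norm_num⟩ ⟨3, 2, by norm_num⟩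
    (fun s t h => strictMono_map₀ (Subtype.coe_lt_coe.mpr h)) ?_ ?_ ?_ ?_
  all_goals
    intro u v
    simp only [← Subtype.coe_le_coe, coe_homeo₀, map₀]
    intros
    split_ifs <;> norm_num <;> linarith

theorem isThompson₁ : IsThompson homeo₁ := by
  refine isThompson_of_steps homeo₁ ⟨1 / 2, by norm_num, by norm_num⟩
    ⟨3 / 4, by norm_num, by norm_num⟩ ⟨7 / 8, by norm_num, by norm_num⟩ 0 (-1) 0 1
    ⟨1, 1, by norm_num⟩ ⟨3, 2, by norm_num⟩ ⟨7, 3, by norm_num⟩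
    (fun s t h => strictMono_map₁ (Subtype.coe_lt_coe.mpr h)) ?_ ?_ ?_ ?_
  all_goals
    intro u v
    simp only [← Subtype.coe_le_coe, coe_homeo₁, map₁]
    intros
    split_ifs <;> norm_num <;> linarith

/-- The standard generator `x₀` of `F`. -/
noncomputable def x₀ : ThompsonF := ⟨homeo₀, isThompson₀⟩

/-- The standard generator `x₁` of `F`. -/
noncomputable def x₁ : ThompsonF := ⟨homeo₁, isThompson₁⟩

end ThompsonF

/-! ## The presentations -/

namespace ThompsonLimit

open scoped commutatorElement

/-- The letters `a`, `b`, `c` of the free group of rank three. -/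
def a : FreeGroup (Fin 3) := FreeGroup.of 0
def b : FreeGroup (Fin 3) := FreeGroup.of 1
def c : FreeGroup (Fin 3) := FreeGroup.of 2

/-- `[b a⁻¹, a⁻¹ b a]` -/
def R₁ : FreeGroup (Fin 3) := ⁅b * a⁻¹, a⁻¹ * b * a⁆

/-- `[b a⁻¹, a⁻² b a²]` -/
def R₂ : FreeGroup (Fin 3) := ⁅b * a⁻¹, (a ^ 2)⁻¹ * b * a ^ 2⁆

/-- The relators of `G_n`. -/
def relsG (n : ℕ) : Set (FreeGroup (Fin 3)) := {R₁, R₂, c⁻¹ * a ^ n}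

/-- The relators of the limit group `G`. -/
def relsLimit : Set (FreeGroup (Fin 3)) :=
  {R₁, R₂, ⁅c, a⁆} ∪
    {w | ∃ i j k : ℕ, 1 ≤ i ∧
      w = ⁅((a ^ j)⁻¹ * b * a ^ j) * a⁻¹, (c ^ i)⁻¹ * ((a ^ k)⁻¹ * b * a ^ k) * c ^ i⁆}

/-- The point of `𝒢_3` given by the group with generators `a`, `b`, `c` and relators `rels`,
marked by `(a, b, c)`. -/
def presented (rels : Set (FreeGroup (Fin 3))) : MarkedGroupSpace 3 :=
  MarkedGroupSpace.mk (fun i => (PresentedGroup.of i : PresentedGroup rels))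
    (PresentedGroup.closure_range_of rels)

end ThompsonLimit

/-! Everything rests on one normal form. Let `τ` be a homomorphism from an ordered abelian group `Λ`
to a group, and write b_x = τ(x)⁻¹ b τ(x). If b τ(ε)⁻¹ commutes with b_x for all x > 0, then b_z b_x
= b_x b_{z+ε} for x < z. When ε ≥ 0 and `b`, `τ` generate the group, these rules bring every element
to the form τ(x) P Q⁻¹ with P and Q nondecreasing positive words in the b_x (`exists_eq_fraction`).

In G_n take Λ = ℤ, τ(k) = a^k, ε = 1; the two relators R₁ and R₂ already force all the commutations
(`commute_shiftConj_zpow`). In G take Λ = ℤ × ℤ ordered lexicographically, τ(i, j) = c^i a^j, ε =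
(0, 1); the infinite family of relators supplies the commutations for i > 0.

In F a fraction is trivial only if x = 0 and P = Q letter by letter (`eq_of_fraction_eq_one`):
conjugation by a power of x₀ turns the equation into one between nondecreasing words in the
generators `X n`, whose letters are recovered from the left ends of supports. Thus a word trivial in
F is trivial in G_n, and G_n presents F.

For the limit, putting c = a^n sends the exponent (i, j) to n i + j, which is strictly increasing on
any given finite set once n is large. A word equals a fraction in G, and since each relator of G
holds in G_n for large n, the equality persists in F for large n. If the word is trivial for
arbitrarily large n, the flattened fraction is trivial, hence so is the original one. Conversely a
relation of G holds in G_n for large n. Balls in the free group are finite, so agreement on each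
word gives convergence.

That x₀ and x₁ generate F is proved separately (`closure_x₀_x₁`) by reducing a pair of standard
dyadic partitions, one carried to the other, through tree rotations. -/

namespace ThompsonF

/-! ### The generators of F as explicit maps -/

/-- The map supported on `[1 - d, 1]` that is there the rescaling of `map₀`. -/
noncomputable def ramp (d t : ℝ) : ℝ :=
  if t ≤ 1 - d then t else if t ≤ 1 - d / 2 then (t + 1 - d) / 2
    else if t ≤ 1 - d / 4 then t - d / 4 else 2 * t - 1

theorem ramp_of_le {d t : ℝ} (h : t ≤ 1 - d) : ramp d t = t := if_pos h

theorem ramp_of_le_half {d t : ℝ} (h : 1 - d ≤ t) (h' : t ≤ 1 - d / 2) :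
    ramp d t = (t + 1 - d) / 2 := by
  unfold ramp
  split_ifs <;> linarith

theorem ramp_of_le_quarter {d t : ℝ} (h : 1 - d / 2 ≤ t) (h' : t ≤ 1 - d / 4) :
    ramp d t = t - d / 4 := by
  unfold ramp
  split_ifs <;> linarith

theorem ramp_of_ge {d t : ℝ} (hd : 0 ≤ d) (h : 1 - d / 4 ≤ t) : ramp d t = 2 * t - 1 := by
  unfold ramp
  split_ifs <;> linarith

/-- Near 1 the outer map is the doubling 2t - 1, which carries [1 - d/2, 1] onto [1 - d, 1] and
conjugates the smaller ramp to the larger. The condition d ≤ e/2 puts the support inside the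
doubling region. This is the source of all relations between the `X n`. -/
theorem ramp_ramp {d e t : ℝ} (hd : 0 < d) (hd' : d ≤ e / 2) :
    ramp e (ramp (d / 2) t) = ramp d (ramp e t) := by
  rcases le_total t (1 - d / 2) with h | h
  · have h' : ramp e t ≤ 1 - d := by
      unfold ramp
      split_ifs <;> linarith
    rw [ramp_of_le h, ramp_of_le h']
  · rw [ramp_of_ge (d := e) (t := t) (by linarith) (by linarith)]
    rcases le_total t (1 - d / 2 / 2) with h₁ | h₁
    · rw [ramp_of_le_half (d := d / 2) (t := t) (by linarith) h₁, ramp_of_ge (by linarith) (by linarith),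
        ramp_of_le_half (by linarith) (by linarith)]
      ring
    rcases le_total t (1 - d / 2 / 4) with h₂ | h₂
    · rw [ramp_of_le_quarter (d := d / 2) (t := t) h₁ h₂, ramp_of_ge (by linarith) (by linarith),
        ramp_of_le_quarter (by linarith) (by linarith)]
      ring
    · rw [ramp_of_ge (d := d / 2) (t := t) (by linarith) h₂, ramp_of_ge (by linarith) (by linarith),
        ramp_of_ge (by linarith) (by linarith)]

theorem ramp_one {t : ℝ} (ht : 0 ≤ t) : ramp 1 t = map₀ t := by
  unfold ramp map₀
  split_ifs <;> linarith

theorem ramp_half (t : ℝ) : ramp (1 / 2) t = map₁ t := by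
  unfold ramp map₁
  split_ifs <;> linarith

theorem ramp_nonneg {d t : ℝ} (hd : d ≤ 1) (ht : 0 ≤ t) : 0 ≤ ramp d t := by
  unfold ramp
  split_ifs <;> linarith

theorem ramp_lt {d t : ℝ} (h : 1 - d < t) (h' : t < 1) : ramp d t < t := by
  unfold ramp
  split_ifs <;> linarith

theorem ramp_le {d t : ℝ} (h : t ≤ 1) : ramp d t ≤ t := by
  unfold ramp
  split_ifs <;> linarith

/-- The infinite sequence of generators of `F`. -/
noncomputable def X : ℕ → ThompsonF
  | 0 => x₀
  | n + 1 => (x₀ ^ n)⁻¹ * x₁ * x₀ ^ n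

theorem X_zero : X 0 = x₀ := rfl

theorem X_one : X 1 = x₁ := by simp [X]

theorem X_succ_succ (n : ℕ) : X (n + 2) = x₀⁻¹ * X (n + 1) * x₀ := by
  simp [X, pow_succ, mul_assoc]

theorem x₀_mul_X (n : ℕ) : x₀ * X (n + 2) = X (n + 1) * x₀ := by
  simp [X_succ_succ, mul_assoc]

theorem ext_coe {f g : ThompsonF} (h : ∀ t : I, (f.1 t : ℝ) = g.1 t) : f = g :=
  Subtype.ext (Homeomorph.ext fun t => Subtype.ext (h t))

/-- Induction along `x₀_mul_X`: both sides are compared after applying the injective `map₀`, where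
`ramp_ramp` with e = 1 identifies them. -/
theorem coe_X (n : ℕ) : ∀ t : I, ((X n).1 t : ℝ) = ramp ((1 / 2) ^ n) t := by
  induction n with
  | zero => intro t; rw [pow_zero, ramp_one t.2.1]; rfl
  | succ n ih =>
    cases n with
    | zero => intro t; rw [X_one, zero_add, pow_one, ramp_half]; rfl
    | succ n =>
      intro t
      have h : (x₀.1 ((X (n + 2)).1 t) : ℝ) = (X (n + 1)).1 (x₀.1 t) :=
        congrArg (fun f : ThompsonF => (f.1 t : ℝ)) (x₀_mul_X n)
      apply strictMono_map₀.injective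
      rw [ih] at h
      change map₀ ((X (n + 2)).1 t) = ramp _ (map₀ t) at h
      rw [h, show ((1 : ℝ) / 2) ^ (n + 1 + 1) = (1 / 2) ^ (n + 1) / 2 by ring,
        ← ramp_one t.2.1, ← ramp_one (ramp_nonneg _ t.2.1), ramp_ramp (by positivity)]
      · calc ((1 : ℝ) / 2) ^ (n + 1) ≤ (1 / 2) ^ 1 :=
              pow_le_pow_of_le_one (by norm_num) (by norm_num) (by omega)
          _ = 1 / 2 := pow_one _
      · have : ((1 : ℝ) / 2) ^ (n + 1) ≤ 1 := pow_le_one₀ (by norm_num) (by norm_num)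
        linarith

theorem X_mul_X_one (n : ℕ) : X (n + 2) * X 1 = X 1 * X (n + 3) := by
  apply ext_coe
  intro t
  change ((X (n + 2)).1 ((X 1).1 t) : ℝ) = (X 1).1 ((X (n + 3)).1 t)
  simp only [coe_X]
  rw [show ((1 : ℝ) / 2) ^ (n + 3) = (1 / 2) ^ (n + 2) / 2 by ring, pow_one]
  refine (ramp_ramp (by positivity) ?_).symm
  calc ((1 : ℝ) / 2) ^ (n + 2) ≤ (1 / 2) ^ 2 :=
        pow_le_pow_of_le_one (by norm_num) (by norm_num) (by omega)
    _ = 1 / 2 / 2 := by norm_num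

/-! ### Uniqueness of nondecreasing positive words -/

/-- The point `1 - 2⁻ʳ`, the left end of the support of `X r`. -/
noncomputable def pt (r : ℕ) : I :=
  ⟨1 - (1 / 2) ^ r, sub_nonneg.mpr (pow_le_one₀ (by norm_num) (by norm_num)),
    sub_le_self _ (by positivity)⟩

theorem coe_pt (r : ℕ) : (pt r : ℝ) = 1 - (1 / 2) ^ r := rfl

theorem pt_strictMono : StrictMono pt := by
  intro r s h
  have : ((1 : ℝ) / 2) ^ s < (1 / 2) ^ r :=
    pow_lt_pow_right_of_lt_one₀ (by norm_num) (by norm_num) h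
  exact Subtype.coe_lt_coe.mp (by simp only [coe_pt]; linarith)

theorem pt_lt_one (r : ℕ) : pt r < 1 :=
  Subtype.coe_lt_coe.mp (by
    have : (0 : ℝ) < (1 / 2) ^ r := by positivity
    change 1 - _ < (1 : ℝ); linarith)

theorem X_apply_of_le {r : ℕ} {t : I} (h : t ≤ pt r) : (X r).1 t = t :=
  Subtype.ext (by rw [coe_X]; exact ramp_of_le (Subtype.coe_le_coe.mpr h))

theorem X_apply_le (r : ℕ) (t : I) : (X r).1 t ≤ t :=
  Subtype.coe_le_coe.mp (by rw [coe_X]; exact ramp_le t.2.2)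

theorem X_apply_lt {r : ℕ} {t : I} (h : pt r < t) (h' : t < 1) : (X r).1 t < t :=
  Subtype.coe_lt_coe.mp (by
    rw [coe_X]; exact ramp_lt (Subtype.coe_lt_coe.mpr h) (Subtype.coe_lt_coe.mpr h'))

theorem strictMono_coe (f : ThompsonF) : StrictMono f.1 := f.2.1

/-- The value of a positive word in the generators `X`. -/
noncomputable def word (l : List ℕ) : ThompsonF := (l.map X).prod

theorem word_cons (m : ℕ) (l : List ℕ) : word (m :: l) = X m * word l := by simp [word]

theorem word_apply_of_le {m : ℕ} {t : I} (ht : t ≤ pt m) {l : List ℕ} (hl : ∀ j ∈ l, m ≤ j) :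
    (word l).1 t = t := by
  induction l with
  | nil => rfl
  | cons j l ih =>
    rw [word_cons]
    change (X j).1 ((word l).1 t) = t
    rw [ih fun i hi => hl i (List.mem_cons_of_mem _ hi)]
    exact X_apply_of_le (ht.trans (pt_strictMono.monotone (hl j List.mem_cons_self)))

theorem word_apply_le (l : List ℕ) (t : I) : (word l).1 t ≤ t := by
  induction l with
  | nil => exact le_rfl
  | cons j l ih =>
    rw [word_cons]
    exact (X_apply_le j _).trans ih

theorem word_cons_apply_lt {m : ℕ} {l : List ℕ} (hl : ∀ j ∈ l, m ≤ j) {t : I} (h : pt m < t)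
    (h' : t < 1) : (word (m :: l)).1 t < t := by
  rw [word_cons]
  have h1 : pt m < (word l).1 t := by
    have := strictMono_coe (word l) h
    rwa [word_apply_of_le le_rfl hl] at this
  have h2 := word_apply_le l t
  exact (X_apply_lt h1 (h2.trans_lt h')).trans_le h2

/-- The point `pt (m + 1)` separates the two: the letter m moves it strictly left and no other
letter moves it back, while letters beyond m all fix it. -/
theorem word_cons_ne_of_lt {m : ℕ} {l l' : List ℕ} (hl : ∀ j ∈ l, m ≤ j)
    (hl' : ∀ j ∈ l', m < j) : word (m :: l) ≠ word l' := by
  intro h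
  have h1 := word_cons_apply_lt hl (pt_strictMono m.lt_succ_self) (pt_lt_one _)
  rw [h, word_apply_of_le le_rfl hl'] at h1
  exact h1.ne rfl

/-- Nondecreasing positive words are determined by their value in `F`. -/
theorem word_injOn {l l' : List ℕ} (hl : l.Pairwise (· ≤ ·)) (hl' : l'.Pairwise (· ≤ ·))
    (h : word l = word l') : l = l' := by
  induction l generalizing l' with
  | nil =>
    cases l' with
    | nil => rfl
    | cons m' l' =>
      exact absurd h.symm (word_cons_ne_of_lt (List.pairwise_cons.mp hl').1 (by simp))
  | cons m l ih =>
    obtain ⟨hm, hl⟩ := List.pairwise_cons.mp hl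
    cases l' with
    | nil => exact absurd h (word_cons_ne_of_lt hm (by simp))
    | cons m' l' =>
      obtain ⟨hm', htl⟩ := List.pairwise_cons.mp hl'
      rcases lt_trichotomy m m' with hlt | rfl | hlt
      · refine absurd h (word_cons_ne_of_lt hm fun j hj => ?_)
        rcases List.mem_cons.mp hj with rfl | hj
        exacts [hlt, hlt.trans_le (hm' j hj)]
      · rw [word_cons, word_cons] at h
        rw [ih hl htl (mul_left_cancel h)]
      · refine absurd h.symm (word_cons_ne_of_lt hm' fun j hj => ?_)
        rcases List.mem_cons.mp hj with rfl | hj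
        exacts [hlt, hlt.trans_le (hm j hj)]

end ThompsonF

/-! ### Standard dyadic intervals and partitions -/

/-- The standard dyadic intervals, given by their endpoints. -/
def IsStandard (α β : ℝ) : Prop := ∃ s e : ℤ, α = s * 2 ^ e ∧ β = (s + 1) * 2 ^ e

theorem IsStandard.scale {α β : ℝ} (h : IsStandard α β) (k : ℤ) :
    IsStandard (2 ^ k * α) (2 ^ k * β) := by
  obtain ⟨s, e, rfl, rfl⟩ := h
  exact ⟨s, e + k, by rw [zpow_add₀ (by norm_num)]; ring, by rw [zpow_add₀ (by norm_num)]; ring⟩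

/-- An interval of length 2^e with e ≤ k starts at a multiple of 2^e, and multiples of 2^k are
multiples of 2^e. -/
theorem IsStandard.translate {α β : ℝ} (h : IsStandard α β) {k : ℤ} (hk : β - α ≤ 2 ^ k) (m : ℤ) :
    IsStandard (α + m * 2 ^ k) (β + m * 2 ^ k) := by
  obtain ⟨s, e, rfl, rfl⟩ := h
  have h1 : (2 : ℝ) ^ e ≤ 2 ^ k := by linarith
  have h2 : e ≤ k := (zpow_le_zpow_iff_right₀ (by norm_num)).mp h1
  obtain ⟨n, rfl⟩ := Int.le.dest h2
  refine ⟨s + m * 2 ^ n, e, ?_, ?_⟩ <;>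
  · rw [zpow_add₀ (by norm_num), zpow_natCast]
    push_cast
    ring

theorem IsStandard.sub_le_left {α β : ℝ} (h : IsStandard α β) (hα : 0 < α) : β - α ≤ α := by
  obtain ⟨s, e, rfl, rfl⟩ := h
  have he : (0 : ℝ) < 2 ^ e := by positivity
  have hs : (0 : ℝ) < s := pos_of_mul_pos_left hα he.le
  have hs' : (1 : ℝ) ≤ s := by exact_mod_cast hs
  nlinarith

/-- A standard dyadic interval containing the midpoint of another one contains that one. -/
theorem IsStandard.le_of_midpoint {α β : ℝ} (h : IsStandard α β) {m k : ℤ}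
    (h₁ : α < (2 * m + 1) * 2 ^ k) (h₂ : (2 * m + 1) * 2 ^ k < β) :
    α ≤ m * 2 ^ (k + 1) ∧ (m + 1) * 2 ^ (k + 1) ≤ β := by
  obtain ⟨s, e, rfl, rfl⟩ := h
  rcases le_or_gt e k with h | h
  · obtain ⟨n, rfl⟩ := Int.le.dest h
    have he : (0 : ℝ) < 2 ^ e := by positivity
    rw [zpow_add₀ (by norm_num), zpow_natCast, mul_comm ((2 : ℝ) ^ e), ← mul_assoc] at h₁ h₂
    have h₃ := lt_of_mul_lt_mul_right h₁ he.le
    have h₄ := lt_of_mul_lt_mul_right h₂ he.le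
    have h₃' : s < (2 * m + 1) * 2 ^ n := by exact_mod_cast h₃
    have h₄' : (2 * m + 1) * 2 ^ n < s + 1 := by exact_mod_cast h₄
    omega
  · obtain ⟨n, rfl⟩ := Int.le.dest (Int.add_one_le_of_lt h)
    have he : (0 : ℝ) < 2 ^ k := by positivity
    have he' : (0 : ℝ) < 2 ^ (k + 1) := by positivity
    have e1 : (2 : ℝ) ^ (k + 1 + n) = 2 ^ n * 2 * 2 ^ k := by
      rw [zpow_add₀ (by norm_num), zpow_natCast, zpow_add₀ (by norm_num), zpow_one]; ring
    have e2 : (2 : ℝ) ^ (k + 1 + n) = 2 ^ n * 2 ^ (k + 1) := by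
      rw [zpow_add₀ (by norm_num), zpow_natCast]; ring
    have h₃ : s * 2 ^ n * 2 < 2 * m + 1 := by
      rw [e1] at h₁
      have : (s * 2 ^ n * 2 : ℝ) < 2 * m + 1 :=
        lt_of_mul_lt_mul_right (by linarith) he.le
      exact_mod_cast this
    have h₄ : 2 * m + 1 < (s + 1) * 2 ^ n * 2 := by
      rw [e1] at h₂
      have : (2 * m + 1 : ℝ) < (s + 1) * 2 ^ n * 2 :=
        lt_of_mul_lt_mul_right (by linarith) he.le
      exact_mod_cast this
    have h₅ : s * 2 ^ n ≤ m := by omega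
    have h₆ : m + 1 ≤ (s + 1) * 2 ^ n := by omega
    have h₅' : (s * 2 ^ n : ℝ) ≤ m := by exact_mod_cast h₅
    have h₆' : (m + 1 : ℝ) ≤ (s + 1) * 2 ^ n := by exact_mod_cast h₆
    rw [e2]
    constructor <;> nlinarith

/-- The complement of `B` is covered by standard dyadic intervals that miss `B`. -/
def StdPartition (B : Finset I) : Prop :=
  ∀ t : I, t ∉ B → ∃ α β : ℝ, IsStandard α β ∧ α < t ∧ (t : ℝ) < β ∧
    ∀ b ∈ B, ¬(α < b ∧ (b : ℝ) < β)

/-- The image of a finite set under a homeomorphism. -/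
def moveFinset (f : I ≃ₜ I) (B : Finset I) : Finset I := B.map f.toEquiv.toEmbedding

theorem mem_moveFinset {f : I ≃ₜ I} {B : Finset I} {t : I} :
    t ∈ moveFinset f B ↔ f.symm t ∈ B := Finset.mem_map_equiv

theorem mem_moveFinset_symm {f : I ≃ₜ I} {B : Finset I} {t : I} :
    t ∈ moveFinset f.symm B ↔ f t ∈ B := mem_moveFinset

theorem apply_mem_moveFinset {f : I ≃ₜ I} {B : Finset I} {t : I} :
    f t ∈ moveFinset f B ↔ t ∈ B := by rw [mem_moveFinset, f.symm_apply_apply]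

theorem LinearOff.mono {f : I ≃ₜ I} {B C : Finset I} (h : LinearOff f B) (hBC : B ⊆ C) :
    LinearOff f C := fun x y hxy => h x y fun b hb => hxy b (hBC hb)

theorem LinearOff.symm {f : I ≃ₜ I} {B : Finset I} (hf : StrictMono f) (h : LinearOff f B) :
    LinearOff f.symm (moveFinset f B) := by
  have hsm : StrictMono f.symm := fun x y hxy => hf.lt_iff_lt.mp (by simpa using hxy)
  intro x y hxy
  obtain ⟨k, hk⟩ := h (f.symm x) (f.symm y) fun b hb hbm =>
    hxy (f b) (apply_mem_moveFinset.mpr hb)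
      ⟨by simpa using hf hbm.1, by simpa using hf hbm.2⟩
  refine ⟨-k, fun u hu v hv => ?_⟩
  have h := hk (f.symm u) ⟨hsm.monotone hu.1, hsm.monotone hu.2⟩
    (f.symm v) ⟨hsm.monotone hv.1, hsm.monotone hv.2⟩
  rw [f.apply_symm_apply, f.apply_symm_apply] at h
  rw [h, ← mul_assoc, ← zpow_add₀ (by norm_num), neg_add_cancel, zpow_zero, one_mul]

theorem LinearOff.comp {f g : I ≃ₜ I} {B : Finset I} (hg : StrictMono g)
    (hf' : LinearOff f B) (hg' : LinearOff g (moveFinset g.symm B)) :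
    LinearOff (f * g) (moveFinset g.symm B) := by
  intro x y hxy
  obtain ⟨k, hk⟩ := hg' x y hxy
  obtain ⟨l, hl⟩ := hf' (g x) (g y) fun b hb hbm =>
    hxy (g.symm b) (mem_moveFinset_symm.mpr (by rwa [g.apply_symm_apply]))
      ⟨hg.lt_iff_lt.mp (by rw [g.apply_symm_apply]; exact hbm.1),
        hg.lt_iff_lt.mp (by rw [g.apply_symm_apply]; exact hbm.2)⟩
  refine ⟨l + k, fun u hu v hv => ?_⟩
  have := hl (g u) ⟨hg.monotone hu.1, hg.monotone hu.2⟩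
    (g v) ⟨hg.monotone hv.1, hg.monotone hv.2⟩
  rw [hk u hu v hv] at this
  rw [zpow_add₀ (by norm_num), mul_assoc]
  exact this

/-- Two fixed endpoints of a linear piece force slope 1. -/
theorem LinearOff.apply_eq_self {f : I ≃ₜ I} {B : Finset I} (h : LinearOff f B) {x y : I}
    (hxy : x < y) (hB : ∀ b ∈ B, b ∉ Set.Ioo x y) (hx : f x = x) (hy : f y = y) {t : I}
    (ht : t ∈ Set.Icc x y) : f t = t := by
  obtain ⟨k, hk⟩ := h x y hB
  have h1 := hk x ⟨le_rfl, hxy.le⟩ y ⟨hxy.le, le_rfl⟩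
  have h2 := hk x ⟨le_rfl, hxy.le⟩ t ht
  rw [hx, hy] at h1
  have h3 : (0 : ℝ) < y - x := sub_pos.mpr hxy
  have h4 : (2 : ℝ) ^ k = 1 := by
    have : (2 : ℝ) ^ k * (y - x) = 1 * (y - x) := by linarith
    exact mul_right_cancel₀ h3.ne' this
  rw [h4, hx] at h2
  exact Subtype.ext (by linarith)

/-! ### Rotations of standard partitions -/

namespace ThompsonF

theorem half_pow_eq (r : ℕ) : ((1 : ℝ) / 2) ^ r = 2 ^ (-(r : ℤ)) := by
  rw [one_div, inv_pow, ← zpow_natCast, ← zpow_neg]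

theorem two_pow_mul_half_pow (r : ℕ) : (2 : ℝ) ^ r * (1 / 2) ^ r = 1 := by
  rw [← mul_pow]; norm_num

theorem coe_pt_succ (r : ℕ) : (pt (r + 1) : ℝ) = 1 - (1 / 2) ^ r / 2 := by
  rw [coe_pt, pow_succ]; ring

theorem coe_X_pt_succ (r : ℕ) : ((X r).1 (pt (r + 1)) : ℝ) = 1 - 3 / 4 * (1 / 2) ^ r := by
  have : (0 : ℝ) < (1 / 2) ^ r := by positivity
  rw [coe_X, ramp_of_le_half] <;> rw [coe_pt_succ] <;> linarith

theorem X_pt_succ_succ (r : ℕ) : (X r).1 (pt (r + 2)) = pt (r + 1) := by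
  have : (0 : ℝ) < (1 / 2) ^ r := by positivity
  apply Subtype.ext
  have e : (pt (r + 2) : ℝ) = 1 - (1 / 2) ^ r / 4 := by rw [coe_pt_succ, pow_succ]; ring
  rw [coe_X, ramp_of_ge this.le e.ge, e, coe_pt_succ]
  ring

/-- The point `pt (r + 1)` is the midpoint of [`pt r`, 1]. A standard interval around it would
contain that whole interval, hence `b`. -/
theorem _root_.StdPartition.pt_succ_mem {B : Finset I} (hB : StdPartition B) {r : ℕ} {b : I}
    (hb : b ∈ B) (h : pt r < b) (h' : b < 1) : pt (r + 1) ∈ B := by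
  by_contra hn
  obtain ⟨α, β, hs, h₁, h₂, h₃⟩ := hB _ hn
  have hd := two_pow_mul_half_pow r
  have e : (pt (r + 1) : ℝ) = (2 * ((2 ^ r - 1 : ℤ) : ℝ) + 1) * 2 ^ (-(r : ℤ) - 1) := by
    rw [coe_pt_succ, zpow_sub₀ (by norm_num), zpow_one, ← half_pow_eq]
    push_cast
    linarith
  rw [e] at h₁ h₂
  obtain ⟨h₄, h₅⟩ := hs.le_of_midpoint h₁ h₂
  rw [sub_add_cancel, ← half_pow_eq] at h₄ h₅
  push_cast at h₄ h₅
  have h : (pt r : ℝ) < b := h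
  have h' : (b : ℝ) < 1 := h'
  rw [coe_pt] at h
  exact h₃ b hb ⟨by linarith, by linarith⟩

/-- Here `X r` sends `pt (r + 1)` to the midpoint of [`pt r`, `pt (r + 1)`], and the midpoint
argument applies to that interval. -/
theorem _root_.StdPartition.X_pt_succ_mem {B : Finset I} (hB : StdPartition B) {r : ℕ} {b : I}
    (hb : b ∈ B) (h : pt r < b) (h' : b < pt (r + 1)) : (X r).1 (pt (r + 1)) ∈ B := by
  by_contra hn
  obtain ⟨α, β, hs, h₁, h₂, h₃⟩ := hB _ hn
  have hd := two_pow_mul_half_pow r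
  have e : ((X r).1 (pt (r + 1)) : ℝ) =
      (2 * ((2 * 2 ^ r - 2 : ℤ) : ℝ) + 1) * 2 ^ (-(r : ℤ) - 1 - 1) := by
    rw [coe_X_pt_succ, zpow_sub₀ (by norm_num), zpow_sub₀ (by norm_num), zpow_one, ← half_pow_eq]
    push_cast
    linarith
  rw [e] at h₁ h₂
  obtain ⟨h₄, h₅⟩ := hs.le_of_midpoint h₁ h₂
  rw [sub_add_cancel, zpow_sub₀ (by norm_num), zpow_one, ← half_pow_eq] at h₄ h₅
  push_cast at h₄ h₅
  have h : (pt r : ℝ) < b := h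
  have h' : (b : ℝ) < pt (r + 1) := h'
  rw [coe_pt] at h
  rw [coe_pt_succ] at h'
  exact h₃ b hb ⟨by linarith, by linarith⟩

/-- The three points of `B` cut [`pt r`, 1] into the images of the linear pieces of `X r`. A
standard interval missing `B` lies in one piece, and the inverse of each affine branch keeps it
standard, by scaling and translation. -/
theorem _root_.StdPartition.rotate {B : Finset I} (hB : StdPartition B) {r : ℕ}
    (h₀ : pt r ∈ B) (h₁ : (X r).1 (pt (r + 1)) ∈ B) (h₂ : pt (r + 1) ∈ B) :
    StdPartition (moveFinset (X r).1.symm B) := by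
  intro t ht
  rw [mem_moveFinset_symm] at ht
  obtain ⟨α, β, hs, hα, hβ, hf⟩ := hB _ ht
  have hd : (0 : ℝ) < (1 / 2) ^ r := by positivity
  have hd1 : ((1 : ℝ) / 2) ^ r ≤ 1 := pow_le_one₀ (by norm_num) (by norm_num)
  have hd2 := two_pow_mul_half_pow r
  have hr := half_pow_eq r
  have out : ∀ b ∈ B, (b : ℝ) ≤ α ∨ β ≤ b := fun b hb => by
    have := hf b hb
    by_contra! hc
    exact this hc
  have out₀ := out _ h₀
  have out₁ := out _ h₁
  have out₂ := out _ h₂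
  rw [coe_pt] at out₀
  rw [coe_X_pt_succ] at out₁
  rw [coe_pt_succ] at out₂
  have ne₀ : (t : ℝ) ≠ 1 - (1 / 2) ^ r := fun h => ht (by
    rw [show t = pt r from Subtype.ext h, X_apply_of_le le_rfl]; exact h₀)
  have ne₁ : (t : ℝ) ≠ 1 - (1 / 2) ^ r / 2 := fun h => ht (by
    rw [show t = pt (r + 1) from Subtype.ext (by rw [h, coe_pt_succ])]; exact h₁)
  have ne₂ : (t : ℝ) ≠ 1 - (1 / 2) ^ r / 4 := fun h => ht (by
    rw [show t = pt (r + 2) from Subtype.ext (by rw [h, coe_pt_succ, pow_succ]; ring),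
      X_pt_succ_succ]
    exact h₂)
  suffices h : ∃ α' β' : ℝ, IsStandard α' β' ∧ α' < t ∧ (t : ℝ) < β' ∧
      ∀ b : I, α' < b → (b : ℝ) < β' → α < (X r).1 b ∧ ((X r).1 b : ℝ) < β by
    obtain ⟨α', β', hs', h₁, h₂, h₃⟩ := h
    exact ⟨α', β', hs', h₁, h₂, fun b hb hb' =>
      hf _ (mem_moveFinset_symm.mp hb) (h₃ b hb'.1 hb'.2)⟩
  simp only [coe_X] at hα hβ ⊢
  generalize ((1 : ℝ) / 2) ^ r = d at *
  rcases lt_or_gt_of_ne ne₀ with h | l₀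
  · rw [ramp_of_le h.le] at hα hβ
    have : β ≤ 1 - d := by rcases out₀ with h' | h' <;> linarith
    refine ⟨α, β, hs, hα, hβ, fun b hb hb' => ?_⟩
    rw [ramp_of_le (by linarith)]
    exact ⟨hb, hb'⟩
  rcases lt_or_gt_of_ne ne₁ with h | l₁
  · rw [ramp_of_le_half l₀.le h.le] at hα hβ
    have l : 1 - d ≤ α := by rcases out₀ with h' | h' <;> linarith
    have u : β ≤ 1 - 3 / 4 * d := by rcases out₁ with h' | h' <;> linarith
    have hk : β - α ≤ 2 ^ (-(r : ℤ) - 1) := by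
      rw [zpow_sub₀ (by norm_num), zpow_one, ← hr]; linarith
    -- The inverse branch is s ↦ 2 (s - (1 - d) / 2), and (1 - d) / 2 = (2^r - 1) 2^(-r-1).
    have hs' := (hs.translate hk (-(2 ^ r - 1))).scale 1
    rw [zpow_sub₀ (by norm_num), ← hr] at hs'
    push_cast at hs'
    refine ⟨_, _, hs', ?_, ?_, fun b hb hb' => ?_⟩
    · rw [zpow_one]; linarith
    · rw [zpow_one]; linarith
    · rw [zpow_one] at hb hb'
      rw [ramp_of_le_half (by linarith) (by linarith)]
      constructor <;> linarith
  rcases lt_or_gt_of_ne ne₂ with h | l₂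
  · rw [ramp_of_le_quarter l₁.le h.le] at hα hβ
    have l : 1 - 3 / 4 * d ≤ α := by rcases out₁ with h' | h' <;> linarith
    have u : β ≤ 1 - d / 2 := by rcases out₂ with h' | h' <;> linarith
    have e : (2 : ℝ) ^ (-(r : ℤ) - 2) = d / 4 := by
      rw [zpow_sub₀ (by norm_num), ← hr]; norm_num
    have hs' := hs.translate (k := -(r : ℤ) - 2) (by rw [e]; linarith) 1
    rw [e] at hs'
    push_cast at hs'
    refine ⟨_, _, hs', by linarith, by linarith, fun b hb hb' => ?_⟩
    rw [ramp_of_le_quarter (by linarith) (by linarith)]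
    constructor <;> linarith
  · rw [ramp_of_ge hd.le l₂.le] at hα hβ
    have l : 1 - d / 2 ≤ α := by rcases out₂ with h' | h' <;> linarith
    have ht1 := t.2.2
    -- With α < 1 this bounds the length by 1, as needed to translate by 1 before halving.
    have hle := hs.sub_le_left (by linarith)
    have hs' := (hs.translate (k := 0) (by rw [zpow_zero]; linarith) 1).scale (-1)
    norm_num at hs'
    refine ⟨_, _, hs', by linarith, by linarith, fun b hb hb' => ?_⟩
    rw [ramp_of_ge hd.le (by linarith)]
    constructor <;> linarith

theorem linearOff_X {r : ℕ} {B : Finset I} (h₀ : pt r ∈ B) (h₁ : pt (r + 1) ∈ B)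
    (h₂ : pt (r + 2) ∈ B) : LinearOff (X r).1 B := by
  intro x y hxy
  have hd : (0 : ℝ) < (1 / 2) ^ r := by positivity
  have out : ∀ b ∈ B, (b : ℝ) ≤ x ∨ (y : ℝ) ≤ b := fun b hb => by
    have := hxy b hb
    by_contra! hc
    exact this ⟨hc.1, hc.2⟩
  have out₀ := out _ h₀
  have out₁ := out _ h₁
  have out₂ := out _ h₂
  rw [coe_pt] at out₀
  rw [coe_pt_succ] at out₁
  rw [coe_pt_succ, pow_succ] at out₂
  simp only [coe_X]
  have hI : ∀ u ∈ Set.Icc x y, (x : ℝ) ≤ u ∧ (u : ℝ) ≤ y := fun u hu => hu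
  rcases out₀ with l₀ | l₀
  swap
  · refine ⟨0, fun u hu v hv => ?_⟩
    have := hI u hu
    have := hI v hv
    rw [ramp_of_le (by linarith), ramp_of_le (by linarith)]
    simp
  rcases out₁ with l₁ | l₁
  swap
  · refine ⟨-1, fun u hu v hv => ?_⟩
    have := hI u hu
    have := hI v hv
    rw [ramp_of_le_half (by linarith) (by linarith), ramp_of_le_half (by linarith) (by linarith)]
    norm_num
    ring
  rcases out₂ with l₂ | l₂
  swap
  · refine ⟨0, fun u hu v hv => ?_⟩
    have := hI u hu
    have := hI v hv
    rw [ramp_of_le_quarter (by linarith) (by linarith),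
      ramp_of_le_quarter (by linarith) (by linarith)]
    simp
  · refine ⟨1, fun u hu v hv => ?_⟩
    have := hI u hu
    have := hI v hv
    rw [ramp_of_ge hd.le (by linarith), ramp_of_ge hd.le (by linarith)]
    norm_num
    ring

theorem apply_zero (f : ThompsonF) : f.1 0 = 0 := f.2.map_zero

theorem apply_one (f : ThompsonF) : f.1 1 = 1 := by
  apply le_antisymm unitInterval.le_one'
  calc (1 : I) = f.1 (f.1.symm 1) := (f.1.apply_symm_apply 1).symm
    _ ≤ f.1 1 := (strictMono_coe f).monotone unitInterval.le_one'

/-! ### Reduction of an element of F to the generators -/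

/-- `f` is the identity up to `pt r` and maps the pieces cut out by `B` linearly to standard
dyadic intervals. -/
structure Adapted (r : ℕ) (f : ThompsonF) (B : Finset I) : Prop where
  fix : ∀ t ≤ pt r, f.1 t = t
  mem : pt r ∈ B
  lin : LinearOff f.1 B
  src : StdPartition B
  tgt : StdPartition (moveFinset f.1 B)

namespace Adapted

variable {r : ℕ} {f : ThompsonF} {B : Finset I}

theorem moveFinset_inv (f : ThompsonF) (B : Finset I) :
    moveFinset f⁻¹.1 (moveFinset f.1 B) = B := by
  ext t
  exact mem_moveFinset_symm.trans apply_mem_moveFinset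

theorem inv (h : Adapted r f B) : Adapted r f⁻¹ (moveFinset f.1 B) where
  fix t ht := by
    change f.1.symm t = t
    rw [Homeomorph.symm_apply_eq, h.fix t ht]
  mem := by
    have := (apply_mem_moveFinset (f := f.1)).mpr h.mem
    rwa [h.fix _ le_rfl] at this
  lin := h.lin.symm (strictMono_coe f)
  src := h.tgt
  tgt := by rw [moveFinset_inv]; exact h.src

theorem rotate (h : Adapted r f B) (h₁ : (X r).1 (pt (r + 1)) ∈ B) (h₂ : pt (r + 1) ∈ B) :
    Adapted r (f * X r) (moveFinset (X r).1.symm B) where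
  fix t ht := by
    change f.1 ((X r).1 t) = t
    rw [X_apply_of_le ht, h.fix t ht]
  mem := mem_moveFinset_symm.mpr (by rw [X_apply_of_le le_rfl]; exact h.mem)
  lin := h.lin.comp (strictMono_coe _) (linearOff_X
    (mem_moveFinset_symm.mpr (by rw [X_apply_of_le le_rfl]; exact h.mem))
    (mem_moveFinset_symm.mpr h₁) (mem_moveFinset_symm.mpr (by rw [X_pt_succ_succ]; exact h₂)))
  src := h.src.rotate h.mem h₁ h₂
  tgt := by
    convert h.tgt using 1
    ext t
    rw [mem_moveFinset, mem_moveFinset_symm, mem_moveFinset]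
    change (X r).1 ((X r).1.symm (f.1.symm t)) ∈ B ↔ _
    rw [Homeomorph.apply_symm_apply]

theorem pt_lt_apply (h : Adapted r f B) {t : I} (ht : pt r < t) : pt r < f.1 t := by
  have := strictMono_coe f ht
  rwa [h.fix _ le_rfl] at this

/-- Without the midpoint `pt (r + 1)` there is no point of `B` strictly between `pt r` and 1, so `f`
is linear there with both ends fixed. -/
theorem eq_one (h : Adapted r f B) (h₁ : pt (r + 1) ∉ B) : f = 1 := by
  apply ext_coe
  intro t
  change ((f.1 t : I) : ℝ) = t
  rcases le_total t (pt r) with ht | ht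
  · rw [h.fix t ht]
  · rw [h.lin.apply_eq_self (pt_lt_one r) (fun b hb hb' => h₁ (h.src.pt_succ_mem hb hb'.1 hb'.2))
      (h.fix _ le_rfl) (apply_one f) ⟨ht, unitInterval.le_one'⟩]

theorem pt_succ_mem_moveFinset (h : Adapted r f B) (h₁ : pt (r + 1) ∈ B) :
    pt (r + 1) ∈ moveFinset f.1 B := by
  refine h.tgt.pt_succ_mem (apply_mem_moveFinset.mpr h₁)
    (h.pt_lt_apply (pt_strictMono r.lt_succ_self)) ?_
  have := strictMono_coe f (pt_lt_one (r + 1))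
  rwa [apply_one] at this

theorem pt_succ_le_apply (h : Adapted r f B) (h₁ : pt (r + 1) ∈ B)
    (h₂ : (X r).1 (pt (r + 1)) ∉ moveFinset f.1 B) : pt (r + 1) ≤ f.1 (pt (r + 1)) := by
  by_contra! hlt
  exact h₂ (h.tgt.X_pt_succ_mem (apply_mem_moveFinset.mpr h₁)
    (h.pt_lt_apply (pt_strictMono r.lt_succ_self)) hlt)

/-- When neither partition subdivides [`pt r`, `pt (r + 1)`], the point `pt (r + 1)` is moved left
neither by `f` nor by `f⁻¹`, so it is fixed and `f` is the identity up to it. -/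
theorem succ (h : Adapted r f B) (h₁ : pt (r + 1) ∈ B)
    (h₂ : (X r).1 (pt (r + 1)) ∉ B) (h₃ : (X r).1 (pt (r + 1)) ∉ moveFinset f.1 B) :
    Adapted (r + 1) f B where
  fix t ht := by
    rcases le_total t (pt r) with ht' | ht'
    · exact h.fix t ht'
    refine h.lin.apply_eq_self (pt_strictMono r.lt_succ_self)
      (fun b hb hb' => h₂ (h.src.X_pt_succ_mem hb hb'.1 hb'.2)) (h.fix _ le_rfl) ?_ ⟨ht', ht⟩
    apply le_antisymm _ (h.pt_succ_le_apply h₁ h₃)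
    have := (strictMono_coe f).monotone (h.inv.pt_succ_le_apply (h.pt_succ_mem_moveFinset h₁)
      (by rwa [moveFinset_inv]))
    change _ ≤ f.1 (f.1.symm _) at this
    rwa [Homeomorph.apply_symm_apply] at this
  mem := h₁
  lin := h.lin
  src := h.src
  tgt := h.tgt

end Adapted

theorem x₀_mem : x₀ ∈ Subgroup.closure ({x₀, x₁} : Set ThompsonF) :=
  Subgroup.subset_closure (by simp)

theorem X_mem (n : ℕ) : X n ∈ Subgroup.closure ({x₀, x₁} : Set ThompsonF) := by
  cases n with
  | zero => exact x₀_mem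
  | succ n =>
    exact mul_mem (mul_mem (inv_mem (pow_mem x₀_mem n)) (Subgroup.subset_closure (by simp)))
      (pow_mem x₀_mem n)

/-- The number of points of `B` beyond `pt r`. -/
noncomputable def tailCard (r : ℕ) (B : Finset I) : ℕ := (B.filter (pt r < ·)).card

/-- The number of points of `B` between `pt r` and `pt (r + 1)`. -/
noncomputable def headCard (r : ℕ) (B : Finset I) : ℕ :=
  (B.filter fun t => pt r < t ∧ t < pt (r + 1)).card

theorem pt_lt_X_apply {r : ℕ} {t : I} (ht : pt r < t) : pt r < (X r).1 t := by
  have := strictMono_coe (X r) ht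
  rwa [X_apply_of_le le_rfl] at this

theorem Adapted.tailCard_moveFinset_le {r : ℕ} {f : ThompsonF} {B : Finset I}
    (h : Adapted r f B) : tailCard r (moveFinset f.1 B) ≤ tailCard r B := by
  refine Finset.card_le_card_of_injOn f.1.symm (fun t ht => ?_) f.1.symm.injective.injOn
  simp only [Finset.mem_coe, Finset.mem_filter, mem_moveFinset] at ht ⊢
  exact ⟨ht.1, h.inv.pt_lt_apply ht.2⟩

theorem tailCard_rotate_le (r : ℕ) (B : Finset I) :
    tailCard r (moveFinset (X r).1.symm B) ≤ tailCard r B := by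
  refine Finset.card_le_card_of_injOn (X r).1 (fun t ht => ?_) (X r).1.injective.injOn
  simp only [Finset.mem_coe, Finset.mem_filter, mem_moveFinset_symm] at ht ⊢
  exact ⟨ht.1, pt_lt_X_apply ht.2⟩

theorem tailCard_succ_lt {r : ℕ} {B : Finset I} (h : pt (r + 1) ∈ B) :
    tailCard (r + 1) B < tailCard r B := by
  have hr := pt_strictMono r.lt_succ_self
  refine Finset.card_lt_card ((Finset.ssubset_iff_of_subset fun t ht => ?_).mpr
    ⟨pt (r + 1), ?_, ?_⟩)
  · simp only [Finset.mem_filter] at ht ⊢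
    exact ⟨ht.1, hr.trans ht.2⟩
  · simp only [Finset.mem_filter]
    exact ⟨h, hr⟩
  · simp

/-- `X r` injects the new head into the old one and misses `X r (pt (r + 1))`, whose preimage is the
excluded right end. -/
theorem headCard_rotate_lt {r : ℕ} {B : Finset I} (h₁ : (X r).1 (pt (r + 1)) ∈ B) :
    headCard r (moveFinset (X r).1.symm B) < headCard r B := by
  have hr := pt_strictMono r.lt_succ_self
  have hX := X_apply_lt hr (pt_lt_one (r + 1))
  rw [headCard, headCard, ← Finset.card_map (X r).1.toEquiv.toEmbedding]
  refine Finset.card_lt_card ((Finset.ssubset_iff_of_subset fun t ht => ?_).mpr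
    ⟨(X r).1 (pt (r + 1)), ?_, ?_⟩)
  · obtain ⟨u, hu, rfl⟩ := Finset.mem_map.mp ht
    simp only [Finset.mem_filter, mem_moveFinset_symm] at hu ⊢
    exact ⟨hu.1, pt_lt_X_apply hu.2.1, (X_apply_le r u).trans_lt hu.2.2⟩
  · simp only [Finset.mem_filter]
    exact ⟨h₁, pt_lt_X_apply hr, hX⟩
  · intro hc
    obtain ⟨u, hu, he⟩ := Finset.mem_map.mp hc
    have : u = pt (r + 1) := (X r).1.injective he
    simp [this] at hu

/-- Double induction: a rotation on either side lowers the total head count without raising the tail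
count; when no rotation is possible, either `f` is 1 or passing from r to r + 1 lowers the tail
count. -/
theorem Adapted.mem_closure {r : ℕ} {f : ThompsonF} {B : Finset I} (h : Adapted r f B) :
    f ∈ Subgroup.closure ({x₀, x₁} : Set ThompsonF) := by
  obtain ⟨n, hn⟩ : ∃ n, tailCard r B < n := ⟨_, Nat.lt_succ_self _⟩
  induction n generalizing r f B with
  | zero => exact absurd hn (Nat.not_lt_zero _)
  | succ n ihn =>
    obtain ⟨m, hm⟩ : ∃ m, headCard r B + headCard r (moveFinset f.1 B) < m :=
      ⟨_, Nat.lt_succ_self _⟩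
    induction m generalizing f B with
    | zero => exact absurd hm (Nat.not_lt_zero _)
    | succ m ihm =>
      -- Multiplying by `X r` on the right rotates the source partition and keeps the target. The
      -- target is rotated by applying the same to `f⁻¹`.
      have key : ∀ {f B}, Adapted r f B → tailCard r B < n + 1 →
          headCard r B + headCard r (moveFinset f.1 B) < m + 1 → pt (r + 1) ∈ B →
          (X r).1 (pt (r + 1)) ∈ B → f ∈ Subgroup.closure ({x₀, x₁} : Set ThompsonF) := by
        intro f B h hn hm h₁ h₂
        have hlt := headCard_rotate_lt h₂
        have e : moveFinset (f * X r).1 (moveFinset (X r).1.symm B) = moveFinset f.1 B := by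
          ext t
          rw [mem_moveFinset, mem_moveFinset_symm, mem_moveFinset]
          change (X r).1 ((X r).1.symm (f.1.symm t)) ∈ B ↔ _
          rw [Homeomorph.apply_symm_apply]
        have := ihm (h.rotate h₂ h₁) ((tailCard_rotate_le r B).trans_lt hn) (by rw [e]; omega)
        exact (Subgroup.mul_mem_cancel_right _ (X_mem r)).mp this
      by_cases h₁ : pt (r + 1) ∈ B
      swap
      · rw [h.eq_one h₁]
        exact one_mem _
      by_cases h₂ : (X r).1 (pt (r + 1)) ∈ B
      · exact key h hn hm h₁ h₂
      by_cases h₃ : (X r).1 (pt (r + 1)) ∈ moveFinset f.1 B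
      · refine inv_mem_iff.mp (key h.inv (h.tailCard_moveFinset_le.trans_lt hn) ?_
          (h.pt_succ_mem_moveFinset h₁) h₃)
        rwa [Adapted.moveFinset_inv, add_comm]
      · exact ihn (h.succ h₁ h₂ h₃) ((tailCard_succ_lt h₁).trans_le (Nat.lt_succ_iff.mp hn))

/-! ### Uniform partitions and generation of F -/

theorem finite_uniform (N : ℕ) : {t : I | ∃ m : ℤ, (t : ℝ) = m / 2 ^ N}.Finite := by
  refine (Set.finite_range fun i : Fin (2 ^ N + 1) =>
    Set.projIcc (0 : ℝ) 1 zero_le_one (i / 2 ^ N)).subset ?_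
  rintro t ⟨m, hm⟩
  have hp : (0 : ℝ) < 2 ^ N := by positivity
  have h0 : (0 : ℝ) ≤ m := by
    have := t.2.1
    rw [hm, le_div_iff₀ hp, zero_mul] at this
    exact this
  have h1 : (m : ℝ) ≤ 2 ^ N := by
    have := t.2.2
    rwa [hm, div_le_one hp] at this
  lift m to ℕ using by exact_mod_cast h0
  refine ⟨⟨m, Nat.lt_succ_iff.mpr (by exact_mod_cast h1)⟩, ?_⟩
  have : ((m : ℝ) / 2 ^ N) = t := by rw [hm, Int.cast_natCast]
  simp only [this, Set.projIcc_val]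

/-- The points of `[0, 1]` with denominator `2 ^ N`. -/
noncomputable def uniform (N : ℕ) : Finset I := (finite_uniform N).toFinset

theorem mem_uniform {N : ℕ} {t : I} : t ∈ uniform N ↔ ∃ m : ℤ, (t : ℝ) = m / 2 ^ N := by
  simp [uniform]

theorem uniform_mono : Monotone uniform := by
  intro M N h t ht
  obtain ⟨m, hm⟩ := mem_uniform.mp ht
  obtain ⟨k, rfl⟩ := Nat.exists_eq_add_of_le h
  exact mem_uniform.mpr ⟨m * 2 ^ k, by rw [hm, pow_add]; push_cast; field_simp⟩

theorem isDyadic_of_mem_uniform {N : ℕ} {t : I} (ht : t ∈ uniform N) : IsDyadic t := by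
  obtain ⟨m, hm⟩ := mem_uniform.mp ht
  exact ⟨m, N, hm⟩

theorem exists_subset_uniform (B : Finset I) (hB : ∀ b ∈ B, IsDyadic b) :
    ∃ N, B ⊆ uniform N := by
  have : ∀ b : I, ∃ N, b ∈ B → b ∈ uniform N := fun b => by
    by_cases hb : b ∈ B
    · obtain ⟨m, N, h⟩ := hB b hb
      exact ⟨N, fun _ => mem_uniform.mpr ⟨m, h⟩⟩
    · exact ⟨0, fun h => absurd h hb⟩
  choose N hN using this
  exact ⟨B.sup N, fun b hb => uniform_mono (Finset.le_sup hb) (hN b hb)⟩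

/-- The piece of the uniform partition around a point. -/
theorem exists_uniform_piece {N : ℕ} {t : I} (ht : t ∉ uniform N) :
    ∃ (s : ℤ) (x y : I), (x : ℝ) = s * 2 ^ (-(N : ℤ)) ∧ (y : ℝ) = (s + 1) * 2 ^ (-(N : ℤ)) ∧
      x < t ∧ t < y ∧ ∀ b ∈ uniform N, b ∉ Set.Ioo x y := by
  have hp : (0 : ℝ) < 2 ^ N := by positivity
  have e : (2 : ℝ) ^ (-(N : ℤ)) = (2 ^ N)⁻¹ := by rw [zpow_neg, zpow_natCast]
  set s := ⌊(t : ℝ) * 2 ^ N⌋ with hs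
  have h₁ : (s : ℝ) ≤ t * 2 ^ N := Int.floor_le _
  have h₂ : (t : ℝ) * 2 ^ N < s + 1 := Int.lt_floor_add_one _
  have h₃ : (s : ℝ) ≠ t * 2 ^ N := fun h => ht (mem_uniform.mpr ⟨s, by rw [h]; field_simp⟩)
  have h₄ : (s : ℝ) < t * 2 ^ N := lt_of_le_of_ne h₁ h₃
  have h₅ : 0 ≤ s := Int.floor_nonneg.mpr (mul_nonneg t.2.1 hp.le)
  have h₅' : (0 : ℝ) ≤ s := by exact_mod_cast h₅
  have h₆ : (s : ℝ) < 2 ^ N := h₄.trans_le (mul_le_of_le_one_left hp.le t.2.2)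
  have h₆' : s + 1 ≤ 2 ^ N := by
    have : s < 2 ^ N := by exact_mod_cast h₆
    omega
  have h₇ : (s : ℝ) + 1 ≤ 2 ^ N := by exact_mod_cast h₆'
  rw [e]
  refine ⟨s, ⟨s * (2 ^ N)⁻¹, by positivity, ?_⟩, ⟨(s + 1) * (2 ^ N)⁻¹, by positivity, ?_⟩, rfl, rfl,
    Subtype.coe_lt_coe.mp ?_, Subtype.coe_lt_coe.mp ?_, fun b hb hb' => ?_⟩
  · rw [← div_eq_mul_inv, div_le_one hp]; linarith
  · rw [← div_eq_mul_inv, div_le_one hp]; exact h₇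
  · change (s : ℝ) * (2 ^ N)⁻¹ < t
    rwa [← div_eq_mul_inv, div_lt_iff₀ hp]
  · change (t : ℝ) < (s + 1) * (2 ^ N)⁻¹
    rwa [← div_eq_mul_inv, lt_div_iff₀ hp]
  · obtain ⟨m, hm⟩ := mem_uniform.mp hb
    have l : (s : ℝ) * (2 ^ N)⁻¹ < b := hb'.1
    have u : (b : ℝ) < (s + 1) * (2 ^ N)⁻¹ := hb'.2
    rw [hm, ← div_eq_mul_inv, div_lt_div_iff_of_pos_right hp] at l
    rw [hm, ← div_eq_mul_inv, div_lt_div_iff_of_pos_right hp] at u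
    have l' : s < m := by exact_mod_cast l
    have u' : m < s + 1 := by exact_mod_cast u
    omega

theorem stdPartition_uniform (N : ℕ) : StdPartition (uniform N) := by
  intro t ht
  obtain ⟨s, x, y, hx, hy, hxt, hty, h⟩ := exists_uniform_piece ht
  exact ⟨x, y, ⟨s, _, hx, hy⟩, hxt, hty, fun b hb hb' => h b hb ⟨hb'.1, hb'.2⟩⟩

/-- On a piece [P, Q] of the coarse partition, f(t) = 2^k t + f(P) - 2^k P, where f(P) is a multiple
of 2^(-L) and 2^k P one of 2^(k-M). Refining to mesh 2^(-L-M) makes the image intervals short enough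
for both translations to keep them standard. -/
theorem stdPartition_moveFinset_uniform (f : ThompsonF) {M L : ℕ} (hM : LinearOff f.1 (uniform M))
    (hL : moveFinset f.1 (uniform M) ⊆ uniform L) :
    StdPartition (moveFinset f.1 (uniform (L + M))) := by
  intro t ht
  rw [mem_moveFinset] at ht
  obtain ⟨u, rfl⟩ := f.1.surjective t
  rw [Homeomorph.symm_apply_apply] at ht
  have hu : u ∉ uniform M := fun h => ht (uniform_mono (Nat.le_add_left M L) h)
  obtain ⟨s, x, y, hx, hy, hxu, huy, h⟩ := exists_uniform_piece ht
  obtain ⟨S, P, Q, hP, hQ, hPu, huQ, hPQ⟩ := exists_uniform_piece hu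
  obtain ⟨k, hk⟩ := hM P Q hPQ
  have hmP : P ∈ uniform M := mem_uniform.mpr
    ⟨S, by rw [hP, zpow_neg, zpow_natCast, div_eq_mul_inv]⟩
  have hmQ : Q ∈ uniform M := mem_uniform.mpr
    ⟨S + 1, by rw [hQ, zpow_neg, zpow_natCast, div_eq_mul_inv]; push_cast; rfl⟩
  have hPx : P ≤ x := by
    by_contra! hc
    exact h P (uniform_mono (Nat.le_add_left M L) hmP) ⟨hc, hPu.trans huy⟩
  have hyQ : y ≤ Q := by
    by_contra! hc
    exact h Q (uniform_mono (Nat.le_add_left M L) hmQ) ⟨hxu.trans huQ, hc⟩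
  have hPI : P ∈ Set.Icc P Q := ⟨le_rfl, (hPu.trans huQ).le⟩
  have hxf := hk P hPI x ⟨hPx, (hxu.trans huQ).le⟩
  have hyf := hk P hPI y ⟨(hPu.trans huy).le, hyQ⟩
  have hQf := hk P hPI Q ⟨(hPu.trans huQ).le, le_rfl⟩
  obtain ⟨i, hi⟩ := mem_uniform.mp (hL (apply_mem_moveFinset.mpr hmP))
  -- The image of [P, Q] has length 2^(k-M) and lies in [0, 1]; hence k ≤ M.
  have hkM : (2 : ℝ) ^ (k - M) ≤ 1 := by
    have h1 := (f.1 Q).2.2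
    have h2 := (f.1 P).2.1
    rw [hP, hQ] at hQf
    rw [sub_eq_add_neg, zpow_add₀ (by norm_num)]
    linarith
  have hkM' : k - M ≤ 0 := by
    rw [← zpow_zero (2 : ℝ)] at hkM
    exact (zpow_le_zpow_iff_right₀ (by norm_num)).mp hkM
  have hst : IsStandard (x : ℝ) y := ⟨s, _, hx, hy⟩
  have hlen : (2 : ℝ) ^ k * y - 2 ^ k * x = 2 ^ (k - (L + M : ℕ)) := by
    rw [hx, hy, sub_eq_add_neg k, zpow_add₀ (by norm_num)]; ring
  have hst₁ := (hst.scale k).translate (k := -(L : ℤ)) (by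
    rw [hlen]
    exact zpow_le_zpow_right₀ (by norm_num) (by push_cast; omega)) i
  have hst₂ := hst₁.translate (k := k - M) (by
    rw [add_sub_add_right_eq_sub, hlen]
    exact zpow_le_zpow_right₀ (by norm_num) (by push_cast; omega)) (-S)
  have e₁ : (i : ℝ) * 2 ^ (-(L : ℤ)) = f.1 P := by
    rw [hi, zpow_neg, zpow_natCast, div_eq_mul_inv]
  have e₂ : ((-S : ℤ) : ℝ) * 2 ^ (k - M) = -(2 ^ k * P) := by
    rw [hP, sub_eq_add_neg, zpow_add₀ (by norm_num)]; push_cast; ring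
  rw [e₁, e₂] at hst₂
  refine ⟨f.1 x, f.1 y, ?_, strictMono_coe f hxu, strictMono_coe f huy, fun b hb hb' => ?_⟩
  · convert hst₂ using 1 <;> linarith
  · rw [mem_moveFinset] at hb
    refine h _ hb ⟨(strictMono_coe f).lt_iff_lt.mp ?_, (strictMono_coe f).lt_iff_lt.mp ?_⟩
    · rw [Homeomorph.apply_symm_apply]; exact hb'.1
    · rw [Homeomorph.apply_symm_apply]; exact hb'.2

/-- Thompson's group `F` is generated by `x₀` and `x₁`. -/
theorem closure_x₀_x₁ : Subgroup.closure ({x₀, x₁} : Set ThompsonF) = ⊤ := by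
  refine (Subgroup.eq_top_iff' _).mpr fun f => ?_
  obtain ⟨B, hB, hlin⟩ := f.2.2
  obtain ⟨M, hM⟩ := exists_subset_uniform B hB
  obtain ⟨L, hL⟩ := exists_subset_uniform (moveFinset f.1 (uniform M)) fun b hb => by
    rw [← f.1.apply_symm_apply b, f.2.isDyadic_iff]
    exact isDyadic_of_mem_uniform (mem_moveFinset.mp hb)
  have hpt : (pt 0 : ℝ) = 0 := by simp [coe_pt]
  have h0 : pt 0 = 0 := Subtype.ext hpt
  have hlin' := hlin.mono hM
  exact Adapted.mem_closure (r := 0) (B := uniform (L + M))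
    { fix := fun t ht => by
        have : t = 0 := le_antisymm (ht.trans_eq h0) unitInterval.nonneg'
        rw [this, apply_zero]
      mem := mem_uniform.mpr ⟨0, by rw [hpt]; simp⟩
      lin := hlin'.mono (uniform_mono (Nat.le_add_left M L))
      src := stdPartition_uniform _
      tgt := stdPartition_moveFinset_uniform f hlin' hL }

end ThompsonF

/-! ### Sorting words and moving inverses to the right -/

section OrderedConjugates

variable {H Λ : Type*} [Group H] [LinearOrder Λ]

/-- Insertion sort: the new letter passes each smaller letter at the cost of being replaced by its
image under `s`. The last clause keeps the inductive list sorted. -/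
theorem exists_pairwise_prod_eq_mul {y : Λ → H} {s : Λ → Λ} (hs : ∀ x, x ≤ s x)
    (hy : ∀ x z, x < z → y z * y x = y x * y (s z)) (z : Λ) {l : List Λ}
    (hl : l.Pairwise (· ≤ ·)) :
    ∃ l' : List Λ, l'.Pairwise (· ≤ ·) ∧ (l'.map y).prod = y z * (l.map y).prod ∧
      ∀ x ∈ l', x ∈ l ∨ z ≤ x := by
  induction l generalizing z with
  | nil => exact ⟨[z], by simp, by simp, by simp⟩
  | cons x l ih =>
    rcases le_or_gt z x with h | h
    · refine ⟨z :: x :: l, List.pairwise_cons.mpr ⟨fun u hu => ?_, hl⟩, by simp, ?_⟩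
      · rcases List.mem_cons.mp hu with rfl | hu
        exacts [h, h.trans ((List.pairwise_cons.mp hl).1 u hu)]
      · intro u hu
        rcases List.mem_cons.mp hu with rfl | hu
        exacts [Or.inr le_rfl, Or.inl hu]
    · obtain ⟨hx, hl⟩ := List.pairwise_cons.mp hl
      obtain ⟨l', hl', hp, hm⟩ := ih (s z) hl
      refine ⟨x :: l', List.pairwise_cons.mpr ⟨fun u hu => ?_, hl'⟩, ?_, fun u hu => ?_⟩
      · rcases hm u hu with hu | hu
        exacts [hx u hu, h.le.trans ((hs z).trans hu)]
      · rw [List.map_cons, List.prod_cons, hp, List.map_cons, List.prod_cons, ← mul_assoc,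
          ← mul_assoc, hy x z h]
      · rcases List.mem_cons.mp hu with rfl | hu
        · exact Or.inl List.mem_cons_self
        · rcases hm u hu with hu | hu
          exacts [Or.inl (List.mem_cons_of_mem _ hu), Or.inr ((hs z).trans hu)]

theorem exists_pairwise_prod_eq {y : Λ → H} {s : Λ → Λ} (hs : ∀ x, x ≤ s x)
    (hy : ∀ x z, x < z → y z * y x = y x * y (s z)) (l : List Λ) :
    ∃ l' : List Λ, l'.Pairwise (· ≤ ·) ∧ (l'.map y).prod = (l.map y).prod := by
  induction l with
  | nil => exact ⟨[], by simp, rfl⟩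
  | cons x l ih =>
    obtain ⟨l₁, h₁, hp₁⟩ := ih
    obtain ⟨l₂, h₂, hp₂, -⟩ := exists_pairwise_prod_eq_mul hs hy x h₁
    exact ⟨l₂, h₂, by rw [hp₂, hp₁, List.map_cons, List.prod_cons]⟩

/-- The inverse letter moves right: past a smaller letter it is itself shifted, past a larger one it
shifts that letter, and at an equal one it cancels. -/
theorem exists_inv_mul_prod_eq {y : Λ → H} {s : Λ → Λ}
    (hy : ∀ x z, x < z → y z * y x = y x * y (s z)) (z : Λ) (l : List Λ) :
    ∃ p q : List Λ, (y z)⁻¹ * (l.map y).prod = (p.map y).prod * ((q.map y).prod)⁻¹ := by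
  induction l generalizing z with
  | nil => exact ⟨[], [z], by simp⟩
  | cons x l ih =>
    rcases lt_trichotomy x z with h | rfl | h
    · obtain ⟨p, q, hpq⟩ := ih (s z)
      refine ⟨x :: p, q, ?_⟩
      have : (y z)⁻¹ * y x = y x * (y (s z))⁻¹ := by
        rw [inv_mul_eq_iff_eq_mul, ← mul_assoc, hy x z h, mul_inv_cancel_right]
      rw [List.map_cons, List.prod_cons, ← mul_assoc, this, mul_assoc, hpq, List.map_cons,
        List.prod_cons, mul_assoc]
    · exact ⟨l, [], by simp⟩
    · obtain ⟨p, q, hpq⟩ := ih z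
      refine ⟨s x :: p, q, ?_⟩
      have : (y z)⁻¹ * y x = y (s x) * (y z)⁻¹ := by
        rw [inv_mul_eq_iff_eq_mul, ← mul_assoc, ← hy z x h, mul_inv_cancel_right]
      rw [List.map_cons, List.prod_cons, ← mul_assoc, this, mul_assoc, hpq, List.map_cons,
        List.prod_cons, mul_assoc]

end OrderedConjugates

/-! ### Fraction normal form for translates of one element -/

section Translates

variable {H Λ : Type*} [Group H] [AddCommGroup Λ]

/-- The conjugate of `b` by the value at `x` of `τ`. -/
def shiftConj (τ : Λ → H) (b : H) (x : Λ) : H := (τ x)⁻¹ * b * τ x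

/-- The element of `H` written `τ x * p * q⁻¹`, with `p` and `q` positive words in the conjugates
of `b`. -/
def fraction (τ : Λ → H) (b : H) (x : Λ) (p q : List Λ) : H :=
  τ x * ((p.map (shiftConj τ b)).prod * ((q.map (shiftConj τ b)).prod)⁻¹)

theorem inv_mul_shiftConj_mul {τ : Λ → H} (hτ : ∀ x z, τ (x + z) = τ x * τ z) (b : H) (x z : Λ) :
    (τ z)⁻¹ * shiftConj τ b x * τ z = shiftConj τ b (x + z) := by
  simp [shiftConj, hτ, mul_assoc]

variable [LinearOrder Λ] [IsOrderedAddMonoid Λ]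

/-- On conjugates with positive index, conjugation by `b` agrees with conjugation by `τ ε`, which
adds ε to the index. The general case is a translate of this one. -/
theorem shiftConj_mul_shiftConj {τ : Λ → H} (hτ : ∀ x z, τ (x + z) = τ x * τ z) {b : H} {ε : Λ}
    (hb : ∀ x, 0 < x → Commute (b * (τ ε)⁻¹) (shiftConj τ b x)) {x z : Λ} (h : x < z) :
    shiftConj τ b z * shiftConj τ b x = shiftConj τ b x * shiftConj τ b (z + ε) := by
  have h0 := hb (z - x) (sub_pos.mpr h)
  have h1 : shiftConj τ b (z - x) * b = b * shiftConj τ b (z - x + ε) := by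
    rw [← inv_mul_shiftConj_mul hτ b (z - x) ε]
    have := h0.eq
    calc _ = (shiftConj τ b (z - x) * (b * (τ ε)⁻¹)) * τ ε := by group
      _ = _ := by rw [← this]; group
  calc shiftConj τ b z * shiftConj τ b x
      = shiftConj τ b (z - x + x) * shiftConj τ b x := by rw [sub_add_cancel]
    _ = (τ x)⁻¹ * (shiftConj τ b (z - x) * b) * τ x := by
        rw [← inv_mul_shiftConj_mul hτ b (z - x) x]
        simp only [shiftConj]; group
    _ = shiftConj τ b x * shiftConj τ b (z - x + ε + x) := by
        rw [h1, ← inv_mul_shiftConj_mul hτ b (z - x + ε) x]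
        simp only [shiftConj]; group
    _ = _ := by rw [show z - x + ε + x = z + ε by abel]

/-- Every element has a fraction normal form with nondecreasing words. -/
theorem exists_eq_fraction {τ : Λ → H} (hτ : ∀ x z, τ (x + z) = τ x * τ z) {b : H} {ε : Λ}
    (hε : 0 ≤ ε) (hb : ∀ x, 0 < x → Commute (b * (τ ε)⁻¹) (shiftConj τ b x))
    (hgen : Subgroup.closure (insert b (Set.range τ)) = ⊤) (g : H) :
    ∃ (x : Λ) (p q : List Λ), p.Pairwise (· ≤ ·) ∧ q.Pairwise (· ≤ ·) ∧
      g = fraction τ b x p q := by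
  have hy : ∀ x z : Λ, x < z → shiftConj τ b z * shiftConj τ b x =
      shiftConj τ b x * shiftConj τ b (z + ε) := fun x z => shiftConj_mul_shiftConj hτ hb
  have hτ0 : τ 0 = 1 := by simpa using hτ 0 0
  have hτneg : ∀ z, (τ z)⁻¹ = τ (-z) := fun z => by
    rw [inv_eq_iff_mul_eq_one, ← hτ, add_neg_cancel, hτ0]
  suffices h : ∃ (x : Λ) (p q : List Λ), g = fraction τ b x p q by
    obtain ⟨x, p, q, rfl⟩ := h
    obtain ⟨p', hp', e₁⟩ := exists_pairwise_prod_eq (s := (· + ε))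
      (fun x => le_add_of_nonneg_right hε) hy p
    obtain ⟨q', hq', e₂⟩ := exists_pairwise_prod_eq (s := (· + ε))
      (fun x => le_add_of_nonneg_right hε) hy q
    exact ⟨x, p', q', hp', hq', by rw [fraction, fraction, e₁, e₂]⟩
  have hg : g ∈ Subgroup.closure (insert b (Set.range τ)) := hgen ▸ Subgroup.mem_top g
  induction hg using Subgroup.closure_induction_left with
  | one => exact ⟨0, [], [], by simp [fraction, hτ0]⟩
  | mul_left u hu g _ ih =>
    obtain ⟨x, p, q, rfl⟩ := ih
    rcases hu with rfl | ⟨z, rfl⟩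
    · exact ⟨x, x :: p, q, by simp only [fraction, List.map_cons, List.prod_cons, shiftConj]; group⟩
    · exact ⟨z + x, p, q, by simp only [fraction, hτ, mul_assoc]⟩
  | inv_mul_cancel u hu g _ ih =>
    obtain ⟨x, p, q, rfl⟩ := ih
    rcases hu with rfl | ⟨z, rfl⟩
    · obtain ⟨p', q', e⟩ := exists_inv_mul_prod_eq (s := (· + ε)) hy x p
      refine ⟨x, p', q ++ q', ?_⟩
      simp only [fraction, List.map_append, List.prod_append, mul_inv_rev]
      rw [← mul_assoc (p'.map _).prod, ← e]
      simp only [shiftConj]; group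
    · exact ⟨-z + x, p, q, by rw [hτneg]; simp only [fraction, hτ, mul_assoc]⟩

end Translates

theorem Commute.inv_mul_mul {H : Type*} [Group H] {x y : H} (h : Commute x y) (g : H) :
    Commute (g⁻¹ * x * g) (g⁻¹ * y * g) := by
  have := h.eq
  calc g⁻¹ * x * g * (g⁻¹ * y * g) = g⁻¹ * (x * y) * g := by group
    _ = g⁻¹ * y * g * (g⁻¹ * x * g) := by rw [this]; group

/-- The first two relations of Thompson's group imply all the others. -/
theorem commute_shiftConj_zpow {H : Type*} [Group H] {a b : H}
    (h₁ : Commute (b * a⁻¹) (a⁻¹ * b * a)) (h₂ : Commute (b * a⁻¹) ((a ^ 2)⁻¹ * b * a ^ 2))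
    {m : ℤ} (hm : 0 < m) : Commute (b * a⁻¹) (shiftConj (fun k : ℤ => a ^ k) b m) := by
  obtain ⟨n, rfl⟩ : ∃ n : ℕ, m = n + 1 := ⟨(m - 1).toNat, by omega⟩
  suffices h : Commute (b * a⁻¹) ((a ^ (n + 1))⁻¹ * b * a ^ (n + 1)) by
    simp only [shiftConj]
    exact_mod_cast h
  clear hm
  suffices h : Commute (b * a⁻¹) ((a ^ (n + 1))⁻¹ * b * a ^ (n + 1)) ∧
      Commute (b * a⁻¹) ((a ^ (n + 2))⁻¹ * b * a ^ (n + 2)) from h.1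
  induction n with
  | zero => exact ⟨by simpa using h₁, h₂⟩
  | succ n ih =>
    refine ⟨ih.2, ?_⟩
    set y := (a ^ (n + 2))⁻¹ * b * a ^ (n + 2) with hy
    have hs : (a ^ (n + 3))⁻¹ * b * a ^ (n + 3) = a⁻¹ * y * a := by
      rw [hy, pow_succ a (n + 2)]; group
    have h := ih.1.inv_mul_mul a
    have e : a⁻¹ * ((a ^ (n + 1))⁻¹ * b * a ^ (n + 1)) * a = y := by
      rw [hy, pow_succ a (n + 1)]; group
    rw [e] at h
    -- The quotient (a⁻¹ b a) a⁻¹ is the conjugate of b a⁻¹ by a, which commutes with y. So the next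
    -- conjugate is a product of elements already known to commute with b a⁻¹.
    have h' : a⁻¹ * y * a = (a⁻¹ * b * a)⁻¹ * y * (a⁻¹ * b * a) := by
      have := h.eq
      calc a⁻¹ * y * a = (a⁻¹ * b * a)⁻¹ * ((a⁻¹ * (b * a⁻¹) * a) * y) * a := by group
        _ = _ := by rw [this]; group
    change Commute (b * a⁻¹) ((a ^ (n + 3))⁻¹ * b * a ^ (n + 3))
    rw [hs, h']
    exact (h₁.inv_right.mul_right ih.2).mul_right h₁

section Fractions

variable {H K Λ M : Type*} [Group H] [Group K]

theorem map_fraction (f : H →* K) (τ : Λ → H) (b : H) (x : Λ) (p q : List Λ) :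
    f (fraction τ b x p q) = fraction (fun z => f (τ z)) (f b) x p q := by
  have h : ∀ z, f (shiftConj τ b z) = shiftConj (fun z => f (τ z)) (f b) z := fun z => by
    simp [shiftConj]
  simp [fraction, map_list_prod, Function.comp_def, h]

theorem fraction_comp (τ : M → H) (g : Λ → M) (b : H) (x : Λ)
    (p q : List Λ) :
    fraction (fun z => τ (g z)) b x p q = fraction τ b (g x) (p.map g) (q.map g) := by
  simp only [fraction, List.map_map]
  rfl

theorem fraction_zero_self [AddCommGroup Λ] {τ : Λ → H} (hτ : τ 0 = 1) (b : H) (p : List Λ) :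
    fraction τ b 0 p p = 1 := by simp [fraction, hτ]

end Fractions

theorem List.eq_of_map_eq_of_injOn {α β : Type*} {f : α → β} {l l' : List α}
    (hf : Set.InjOn f {x | x ∈ l ∨ x ∈ l'}) (h : l.map f = l'.map f) : l = l' := by
  induction l generalizing l' with
  | nil => simpa using h.symm
  | cons x l ih =>
    cases l' with
    | nil => simp at h
    | cons x' l' =>
      simp only [List.map_cons, List.cons.injEq] at h
      have e : x = x' := hf (by simp) (by simp) h.1
      rw [e, ih (hf.mono fun z hz => by simp at hz ⊢; tauto) h.2]

/-! ### Trivial fractions in F -/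

namespace ThompsonF

theorem commute_X (n : ℕ) : Commute (x₁ * x₀⁻¹) (X (n + 2)) := by
  have h₁ := X_mul_X_one n
  have h₂ := X_succ_succ (n + 1)
  rw [X_one, h₂] at h₁
  calc x₁ * x₀⁻¹ * X (n + 2) = x₁ * (x₀⁻¹ * X (n + 1 + 1) * x₀) * x₀⁻¹ := by group
    _ = X (n + 2) * (x₁ * x₀⁻¹) := by rw [← h₁]; group

theorem shiftConj_of_nonneg {i : ℤ} (hi : 0 ≤ i) :
    shiftConj (fun k : ℤ => x₀ ^ k) x₁ i = X (i.toNat + 1) := by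
  lift i to ℕ using hi
  simp [shiftConj, X]

theorem commute_shiftConj {m : ℤ} (hm : 0 < m) :
    Commute (x₁ * x₀⁻¹) (shiftConj (fun k : ℤ => x₀ ^ k) x₁ m) := by
  rw [shiftConj_of_nonneg hm.le]
  obtain ⟨n, hn⟩ : ∃ n : ℕ, m.toNat = n + 1 := ⟨m.toNat - 1, by omega⟩
  rw [hn]
  exact commute_X n

/-- The index in the sequence `X` of the conjugate of `x₁` by `x₀ ^ (i + s)`. -/
def index (s : ℕ) (i : ℤ) : ℕ := (i + s).toNat + 1

/-- Conjugation by a large power of x₀ makes all exponents nonnegative, where the conjugates of x₁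
are the generators `X n` with n ≥ 1. -/
theorem conj_prod_eq_word {s : ℕ} {p : List ℤ} (hp : ∀ i ∈ p, 0 ≤ i + s) :
    (x₀ ^ s)⁻¹ * (p.map (shiftConj (fun k : ℤ => x₀ ^ k) x₁)).prod * x₀ ^ s =
      word (p.map (index s)) := by
  induction p with
  | nil => simp [word]
  | cons i p ih =>
    rw [List.map_cons, List.map_cons, word_cons, ← ih fun j hj => hp j (List.mem_cons_of_mem _ hj),
      index, ← shiftConj_of_nonneg (hp i List.mem_cons_self),
      ← inv_mul_shiftConj_mul (fun x z => zpow_add x₀ x z), zpow_natCast, List.prod_cons]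
    group

theorem pairwise_map_index (s : ℕ) {p : List ℤ} (hp : p.Pairwise (· ≤ ·)) :
    (p.map (index s)).Pairwise (· ≤ ·) :=
  hp.map _ fun i j h => by unfold index; omega

/-- Since x₀ = `X 0` and all other letters have index at least 1, the left side becomes a
nondecreasing word with n leading zeros. Uniqueness of such words leaves no room for a zero. -/
theorem eq_zero_and_eq_of_pow_mul_eq {n s : ℕ} {p q : List ℤ} (hp : p.Pairwise (· ≤ ·))
    (hq : q.Pairwise (· ≤ ·)) (hps : ∀ i ∈ p, 0 ≤ i + s) (hqs : ∀ i ∈ q, 0 ≤ i + s)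
    (h : x₀ ^ n * (p.map (shiftConj (fun k : ℤ => x₀ ^ k) x₁)).prod =
      (q.map (shiftConj (fun k : ℤ => x₀ ^ k) x₁)).prod) : n = 0 ∧ p = q := by
  have h₁ : word (List.replicate n 0 ++ p.map (index s)) = word (q.map (index s)) := by
    rw [← conj_prod_eq_word hqs, ← h, word, List.map_append, List.prod_append]
    change _ * word _ = _
    rw [← conj_prod_eq_word hps]
    simp only [List.map_replicate, List.prod_replicate, X_zero]
    group
  have h₂ := word_injOn (List.pairwise_append.mpr ⟨List.pairwise_replicate_of_refl,
    pairwise_map_index s hp, fun i hi j _ => by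
      rw [List.eq_of_mem_replicate hi]; exact Nat.zero_le _⟩) (pairwise_map_index s hq) h₁
  have hn : n = 0 := by
    by_contra hn
    have : 0 ∈ q.map (index s) := h₂ ▸ List.mem_append_left _ (by simp [hn])
    simp [index] at this
  subst hn
  refine ⟨rfl, List.eq_of_map_eq_of_injOn (fun i hi j hj hij => ?_) h₂⟩
  have hi' : 0 ≤ i + s := hi.elim (hps i) (hqs i)
  have hj' : 0 ≤ j + s := hj.elim (hps j) (hqs j)
  unfold index at hij
  omega

/-- The fraction normal form in `F` detects the identity. -/
theorem eq_of_fraction_eq_one {k : ℤ} {p q : List ℤ} (hp : p.Pairwise (· ≤ ·))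
    (hq : q.Pairwise (· ≤ ·)) (h : fraction (fun k : ℤ => x₀ ^ k) x₁ k p q = 1) :
    k = 0 ∧ p = q := by
  obtain ⟨s, hs⟩ : ∃ s : ℕ, ∀ i ∈ p ++ q, 0 ≤ i + s := by
    generalize p ++ q = l
    induction l with
    | nil => exact ⟨0, by simp⟩
    | cons i l ih =>
      obtain ⟨s, hs⟩ := ih
      refine ⟨s + i.natAbs, fun j hj => ?_⟩
      rcases List.mem_cons.mp hj with rfl | hj
      · omega
      · have := hs j hj
        omega
  have hps : ∀ i ∈ p, 0 ≤ i + s := fun i hi => hs i (List.mem_append_left _ hi)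
  have hqs : ∀ i ∈ q, 0 ≤ i + s := fun i hi => hs i (List.mem_append_right _ hi)
  rw [fraction, ← mul_assoc, mul_inv_eq_one] at h
  obtain ⟨n, rfl | rfl⟩ := k.eq_nat_or_neg
  · rw [zpow_natCast] at h
    obtain ⟨rfl, e⟩ := eq_zero_and_eq_of_pow_mul_eq hp hq hps hqs h
    exact ⟨rfl, e⟩
  · rw [zpow_neg, zpow_natCast, inv_mul_eq_iff_eq_mul] at h
    obtain ⟨rfl, e⟩ := eq_zero_and_eq_of_pow_mul_eq hq hp hqs hps h.symm
    exact ⟨rfl, e.symm⟩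

end ThompsonF

/-! ### The presentation of F -/

namespace ThompsonLimit

open scoped commutatorElement
open ThompsonF

theorem relations_presented (rels : Set (FreeGroup (Fin 3))) :
    (presented rels).relations = Subgroup.normalClosure rels := by
  change (FreeGroup.lift fun i => (PresentedGroup.of i : PresentedGroup rels)).ker = _
  have : (FreeGroup.lift fun i => (PresentedGroup.of i : PresentedGroup rels)) =
      PresentedGroup.mk rels := FreeGroup.ext_hom _ _ fun i => by rw [FreeGroup.lift_apply_of]; rfl
  rw [this]
  exact QuotientGroup.ker_mk' _

theorem mk_eq_one_iff {rels : Set (FreeGroup (Fin 3))} {w : FreeGroup (Fin 3)} :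
    PresentedGroup.mk rels w = 1 ↔ w ∈ Subgroup.normalClosure rels :=
  QuotientGroup.eq_one_iff w

theorem mk_eq_one_of_mem {rels : Set (FreeGroup (Fin 3))} {w : FreeGroup (Fin 3)} (h : w ∈ rels) :
    PresentedGroup.mk rels w = 1 := mk_eq_one_iff.mpr (Subgroup.subset_normalClosure h)

/-- The marking of `F` by `x₀`, `x₁`, `x₀ ^ n`. -/
noncomputable def toF (n : ℕ) : FreeGroup (Fin 3) →* ThompsonF :=
  FreeGroup.lift ![x₀, x₁, x₀ ^ n]

theorem toF_a (n : ℕ) : toF n a = x₀ := by simp [toF, a]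

theorem toF_b (n : ℕ) : toF n b = x₁ := by simp [toF, b]

theorem toF_c (n : ℕ) : toF n c = x₀ ^ n := by simp [toF, c]

theorem closure_abc {H : Type*} [Group H] {f : FreeGroup (Fin 3) →* H}
    (hf : Function.Surjective f) : Subgroup.closure ({f a, f b, f c} : Set H) = ⊤ := by
  have h := FreeGroup.closure_range_of (Fin 3)
  have h' := congrArg (Subgroup.map f) h
  rw [MonoidHom.map_closure, ← MonoidHom.range_eq_map, MonoidHom.range_eq_top.mpr hf] at h'
  rw [← h']
  congr 1
  ext x
  simp [Set.mem_image, Fin.exists_fin_succ, a, b, c, eq_comm]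

theorem toF_R₁ (n : ℕ) : toF n R₁ = 1 := by
  rw [R₁, map_commutatorElement, commutatorElement_eq_one_iff_commute]
  simp only [map_mul, map_inv, toF_a, toF_b]
  simpa [shiftConj] using commute_shiftConj one_pos

theorem toF_R₂ (n : ℕ) : toF n R₂ = 1 := by
  rw [R₂, map_commutatorElement, commutatorElement_eq_one_iff_commute]
  simp only [map_mul, map_inv, map_pow, toF_a, toF_b]
  exact_mod_cast commute_shiftConj (m := 2) two_pos

theorem commute_of_R {H : Type*} [Group H] {f : FreeGroup (Fin 3) →* H} (h₁ : f R₁ = 1)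
    (h₂ : f R₂ = 1) {m : ℤ} (hm : 0 < m) :
    Commute (f b * (f a)⁻¹) (shiftConj (fun k : ℤ => f a ^ k) (f b) m) := by
  rw [R₁, map_commutatorElement, commutatorElement_eq_one_iff_commute] at h₁
  rw [R₂, map_commutatorElement, commutatorElement_eq_one_iff_commute] at h₂
  simp only [map_mul, map_inv, map_pow] at h₁ h₂
  exact commute_shiftConj_zpow h₁ h₂ hm

theorem normalClosure_le_ker_toF (n : ℕ) :
    Subgroup.normalClosure (relsG n) ≤ (toF n).ker := by
  refine Subgroup.normalClosure_le_normal ?_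
  rintro w (rfl | rfl | rfl)
  · exact toF_R₁ n
  · exact toF_R₂ n
  · change toF n _ = 1
    rw [map_mul, map_inv, map_pow, toF_a, toF_c, inv_mul_cancel]

/-- The relators of `G_n` present Thompson's group. -/
theorem ker_toF (n : ℕ) : (toF n).ker = Subgroup.normalClosure (relsG n) := by
  refine le_antisymm (fun w hw => ?_) (normalClosure_le_ker_toF n)
  rw [← mk_eq_one_iff]
  set f := PresentedGroup.mk (relsG n) with hf
  have hc : f c = f a ^ n := by
    have : f (c⁻¹ * a ^ n) = 1 := mk_eq_one_of_mem (by simp [relsG])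
    rw [map_mul, map_inv, map_pow, inv_mul_eq_one] at this
    exact this
  have hgen : Subgroup.closure (insert (f b) (Set.range fun k : ℤ => f a ^ k)) = ⊤ := by
    rw [eq_top_iff, ← closure_abc (PresentedGroup.mk_surjective (relsG n)), Subgroup.closure_le]
    rintro x (rfl | rfl | rfl)
    · exact Subgroup.subset_closure (Or.inr ⟨1, zpow_one _⟩)
    · exact Subgroup.subset_closure (Or.inl rfl)
    · exact Subgroup.subset_closure (Or.inr ⟨n, by simp only [zpow_natCast]; exact hc.symm⟩)
  obtain ⟨k, p, q, hp, hq, e⟩ := exists_eq_fraction (ε := (1 : ℤ))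
    (fun x z => zpow_add (f a) x z) zero_le_one (fun m hm => by
      simp only [zpow_one]
      exact commute_of_R (mk_eq_one_of_mem (by simp [relsG]))
        (mk_eq_one_of_mem (by simp [relsG])) hm) hgen (f w)
  -- The fraction is lifted to the free group, so that its equality with `w` can be transported to
  -- F.
  have e' : f (w * (fraction (fun k : ℤ => a ^ k) b k p q)⁻¹) = 1 := by
    rw [map_mul, map_inv, map_fraction, e]
    simp
  have e'' := normalClosure_le_ker_toF n (mk_eq_one_iff.mp e')
  rw [MonoidHom.mem_ker, map_mul, map_inv, hw, one_mul, inv_eq_one, map_fraction] at e''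
  simp only [map_zpow, toF_a, toF_b] at e''
  obtain ⟨rfl, rfl⟩ := eq_of_fraction_eq_one hp hq e''
  rw [e, fraction_zero_self (zpow_zero _)]

/-! ### Lexicographic exponents and the limit group -/

/-- The value at `n` of a pair of exponents of `c` and `a`, when `c = a ^ n`. -/
def flatten (n : ℕ) (x : ℤ ×ₗ ℤ) : ℤ := n * (ofLex x).1 + (ofLex x).2

/-- A positive gap in the first coordinate contributes at least n, which eventually outweighs any
fixed difference in the second. -/
theorem eventually_flatten_lt {x y : ℤ ×ₗ ℤ} (h : x < y) :
    ∀ᶠ n : ℕ in atTop, flatten n x < flatten n y := by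
  rcases Prod.Lex.lt_iff.mp h with h | ⟨h₁, h₂⟩
  · filter_upwards [eventually_gt_atTop ((ofLex x).2 - (ofLex y).2).natAbs] with n hn
    have : ((ofLex x).2 - (ofLex y).2) < n := by omega
    unfold flatten
    nlinarith
  · exact Eventually.of_forall fun n => by
      unfold flatten
      rw [h₁]
      omega

theorem eventually_strictMonoOn_flatten {S : Set (ℤ ×ₗ ℤ)} (hS : S.Finite) :
    ∀ᶠ n : ℕ in atTop, StrictMonoOn (flatten n) S := by
  refine (hS.eventually_all.mpr fun x _ => hS.eventually_all.mpr fun y _ =>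
    eventually_imp_distrib_left.mpr (eventually_flatten_lt (x := x) (y := y))).mono
    fun n h x hx y hy => h x hx y hy

/-- The product of powers of `c` and `a` with the given exponents. -/
def torus {H : Type*} [Group H] (f : FreeGroup (Fin 3) →* H) (x : ℤ ×ₗ ℤ) : H :=
  f c ^ (ofLex x).1 * f a ^ (ofLex x).2

theorem map_torus_id {H : Type*} [Group H] (f : FreeGroup (Fin 3) →* H) (x : ℤ ×ₗ ℤ) :
    f (torus (MonoidHom.id _) x) = torus f x := by simp [torus]

theorem torus_toF (n : ℕ) (x : ℤ ×ₗ ℤ) : torus (toF n) x = x₀ ^ flatten n x := by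
  rw [torus, toF_a, toF_c, flatten, zpow_add, zpow_mul, zpow_natCast]

theorem torus_add {H : Type*} [Group H] {f : FreeGroup (Fin 3) →* H} (h : Commute (f c) (f a))
    (x y : ℤ ×ₗ ℤ) : torus f (x + y) = torus f x * torus f y := by
  have := (h.zpow_zpow (ofLex y).1 (ofLex x).2).eq
  simp only [torus, ofLex_add, Prod.fst_add, Prod.snd_add, zpow_add]
  simp only [mul_assoc]
  rw [← mul_assoc (f a ^ _) (f c ^ _), ← this]
  simp only [mul_assoc]

/-- If the exponent of c is positive, this is a relator of the infinite family conjugated by a power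
of a; if it is zero, it follows from R₁ and R₂. -/
theorem commute_of_relsLimit {H : Type*} [Group H] {f : FreeGroup (Fin 3) →* H}
    (hf : ∀ w ∈ relsLimit, f w = 1) {x : ℤ ×ₗ ℤ} (hx : 0 < x) :
    Commute (f b * (torus f (toLex (0, 1)))⁻¹) (shiftConj (torus f) (f b) x) := by
  have hca : Commute (f c) (f a) := by
    have := hf ⁅c, a⁆ (by simp [relsLimit])
    rwa [map_commutatorElement, commutatorElement_eq_one_iff_commute] at this
  have hε : torus f (toLex (0, 1)) = f a := by simp [torus]
  rw [hε]
  rcases Prod.Lex.lt_iff.mp hx with h | ⟨h₁, h₂⟩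
  · change 0 < (ofLex x).1 at h
    obtain ⟨i, hi⟩ : ∃ i : ℕ, (ofLex x).1 = i := ⟨_, (Int.toNat_of_nonneg h.le).symm⟩
    -- Positive and negative parts: conjugating the relator by a^(-j) turns its second entry into
    -- the conjugate of b by c^i a^(k-j), so natural j, k reach every integer exponent.
    obtain ⟨j, k, hjk⟩ : ∃ j k : ℕ, (ofLex x).2 = k - j :=
      ⟨(-(ofLex x).2).toNat, (ofLex x).2.toNat, by omega⟩
    have hr := hf _ (Or.inr ⟨i, j, k, by omega, rfl⟩)
    rw [map_commutatorElement, commutatorElement_eq_one_iff_commute] at hr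
    simp only [map_mul, map_inv, map_pow] at hr
    have hr' := hr.inv_mul_mul (f a ^ (-(j : ℤ)))
    have e : torus f x = f a ^ k * f c ^ i * f a ^ (-(j : ℤ)) := by
      rw [torus, hi, hjk, zpow_natCast, sub_eq_add_neg, zpow_add, ← mul_assoc, zpow_natCast,
        (hca.pow_pow i k).eq]
    convert hr' using 1
    · group
    · rw [shiftConj, e]
      group
  · change 0 = (ofLex x).1 at h₁
    change 0 < (ofLex x).2 at h₂
    have := commute_of_R (hf R₁ (by simp [relsLimit])) (hf R₂ (by simp [relsLimit])) h₂
    have e : torus f x = f a ^ (ofLex x).2 := by rw [torus, ← h₁, zpow_zero, one_mul]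
    rwa [shiftConj, e]

/-- Each relator holds in F for large n, and the words that eventually become trivial form a normal
subgroup. -/
theorem eventually_toF_eq_one {w : FreeGroup (Fin 3)}
    (hw : w ∈ Subgroup.normalClosure relsLimit) : ∀ᶠ n : ℕ in atTop, toF n w = 1 := by
  have comm : ∀ n, Commute (toF n c) (toF n a) := fun n => by
    rw [toF_a, toF_c]; exact Commute.pow_left rfl n
  have of_mem : ∀ w ∈ relsLimit, ∀ᶠ n : ℕ in atTop, toF n w = 1 := by
    intro w hw
    rcases hw with (rfl | rfl | rfl) | ⟨i, j, k, hi, rfl⟩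
    · exact Eventually.of_forall toF_R₁
    · exact Eventually.of_forall toF_R₂
    · exact Eventually.of_forall fun n => by
        rw [map_commutatorElement, commutatorElement_eq_one_iff_commute]
        exact comm n
    -- After c = a^n the index of the second entry relative to the first is k + n i - j, positive
    -- once n > j because i ≥ 1.
    · filter_upwards [eventually_gt_atTop j] with n hn
      rw [map_commutatorElement, commutatorElement_eq_one_iff_commute]
      simp only [map_mul, map_inv, map_pow, toF_a, toF_b, toF_c]
      have hm : (0 : ℤ) < k + n * i - j := by
        have : (n : ℤ) ≤ n * i := le_mul_of_one_le_right (by omega) (by omega)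
        omega
      convert (commute_shiftConj hm).inv_mul_mul (x₀ ^ j) using 1
      · group
      · simp only [shiftConj, ← zpow_natCast, ← zpow_mul]
        group
  induction hw using Subgroup.closure_induction with
  | mem w hw =>
    obtain ⟨v, hv, hvw⟩ := Group.mem_conjugatesOfSet_iff.mp hw
    obtain ⟨g, rfl⟩ := isConj_iff.mp hvw
    filter_upwards [of_mem v hv] with n h
    rw [map_mul, map_mul, h, map_inv, mul_one, mul_inv_cancel]
  | one => exact Eventually.of_forall fun n => map_one _
  | mul x y _ _ hx hy =>
    filter_upwards [hx, hy] with n h₁ h₂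
    rw [map_mul, h₁, h₂, one_mul]
  | inv x _ hx =>
    filter_upwards [hx] with n h
    rw [map_inv, h, inv_one]

/-- One n suffices, provided that the equality of `w` with its fraction in G survives in F and that
flattening is strictly increasing on the exponents involved: then the trivial fraction in F forces
the fraction in G to be trivial. -/
theorem mem_normalClosure_of_frequently {w : FreeGroup (Fin 3)}
    (hw : ∃ᶠ n : ℕ in atTop, toF n w = 1) : w ∈ Subgroup.normalClosure relsLimit := by
  rw [← mk_eq_one_iff]
  set f := PresentedGroup.mk relsLimit with hf
  have hrel : ∀ w ∈ relsLimit, f w = 1 := fun w hw => mk_eq_one_of_mem hw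
  have hca : Commute (f c) (f a) := by
    have := hrel ⁅c, a⁆ (by simp [relsLimit])
    rwa [map_commutatorElement, commutatorElement_eq_one_iff_commute] at this
  have hgen : Subgroup.closure (insert (f b) (Set.range (torus f))) = ⊤ := by
    rw [eq_top_iff, ← closure_abc (PresentedGroup.mk_surjective relsLimit), Subgroup.closure_le]
    rintro x (rfl | rfl | rfl)
    · exact Subgroup.subset_closure (Or.inr ⟨toLex (0, 1), by simp [torus, hf]⟩)
    · exact Subgroup.subset_closure (Or.inl rfl)
    · exact Subgroup.subset_closure (Or.inr ⟨toLex (1, 0), by simp [torus, hf]⟩)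
  obtain ⟨x, p, q, hp, hq, e⟩ := exists_eq_fraction (ε := toLex ((0 : ℤ), (1 : ℤ)))
    (torus_add hca) (Prod.Lex.le_iff.mpr (Or.inr ⟨rfl, zero_le_one⟩))
    (fun m hm => commute_of_relsLimit hrel hm) hgen (f w)
  have e' : f (w * (fraction (torus (MonoidHom.id _)) b x p q)⁻¹) = 1 := by
    rw [map_mul, map_inv, map_fraction, e]
    simp only [map_torus_id, mul_inv_cancel]
  -- Zero is included so that a vanishing flattened exponent gives x = 0 by injectivity.
  have hS : {z | z = x ∨ z = 0 ∨ z ∈ p ∨ z ∈ q}.Finite := by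
    have : {z | z = x ∨ z = 0 ∨ z ∈ p ∨ z ∈ q} = {z | z ∈ x :: 0 :: (p ++ q)} := by
      ext z; simp
    rw [this]
    exact List.finite_toSet _
  obtain ⟨n, hn, hn₁, hn₂⟩ := (hw.and_eventually ((eventually_toF_eq_one
    (mk_eq_one_iff.mp e')).and (eventually_strictMonoOn_flatten hS))).exists
  rw [map_mul, map_inv, hn, one_mul, inv_eq_one, map_fraction] at hn₁
  have ht : (fun z => toF n (torus (MonoidHom.id _) z)) = fun z => x₀ ^ flatten n z := by
    funext z
    rw [← torus_toF, map_torus_id]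
  rw [ht, toF_b, fraction_comp (fun k : ℤ => x₀ ^ k)] at hn₁
  have hmap : ∀ l : List (ℤ ×ₗ ℤ), (∀ z ∈ l, z ∈ p ∨ z ∈ q) → l.Pairwise (· ≤ ·) →
      (l.map (flatten n)).Pairwise (· ≤ ·) := fun l hl h =>
    List.pairwise_map.mpr (h.imp_of_mem fun {y z} hy hz hyz =>
      hn₂.monotoneOn (Or.inr (Or.inr (hl y hy))) (Or.inr (Or.inr (hl z hz))) hyz)
  obtain ⟨h₁, h₂⟩ := eq_of_fraction_eq_one (hmap p (fun _ => Or.inl) hp)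
    (hmap q (fun _ => Or.inr) hq) hn₁
  have hx : x = 0 := hn₂.injOn (Or.inl rfl) (Or.inr (Or.inl rfl)) (by
    rw [h₁]; simp [flatten])
  have hpq : p = q := List.eq_of_map_eq_of_injOn
    (hn₂.injOn.mono fun z hz => Or.inr (Or.inr hz)) h₂
  rw [e, hx, hpq, fraction_zero_self (by simp [torus])]

theorem eventually_mem_iff (w : FreeGroup (Fin 3)) : ∀ᶠ n : ℕ in atTop,
    w ∈ Subgroup.normalClosure (relsG n) ↔ w ∈ Subgroup.normalClosure relsLimit := by
  simp only [← ker_toF, MonoidHom.mem_ker]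
  by_cases hw : w ∈ Subgroup.normalClosure relsLimit
  · filter_upwards [eventually_toF_eq_one hw] with n hn
    simp [hn, hw]
  · filter_upwards [not_frequently.mp (mt mem_normalClosure_of_frequently hw)] with n hn
    simp [hn, hw]

end ThompsonLimit

/-! ### Convergence in the space of marked groups -/

theorem FreeGroup.finite_norm_le {α : Type*} [Finite α] [DecidableEq α] (R : ℕ) :
    {w : FreeGroup α | w.norm ≤ R}.Finite :=
  Set.Finite.of_finite_image (f := FreeGroup.toWord)
    ((List.finite_length_le (α × Bool) R).subset (by rintro _ ⟨w, hw, rfl⟩; exact hw))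
    FreeGroup.toWord_injective.injOn

/-- Convergence of marked groups is convergence of the sets of relations. -/
theorem MarkedGroupSpace.tendsto_of_eventually_mem_iff {k : ℕ} {u : ℕ → MarkedGroupSpace k}
    {x : MarkedGroupSpace k}
    (h : ∀ w, ∀ᶠ n in atTop, w ∈ (u n).relations ↔ w ∈ x.relations) :
    Tendsto u atTop (𝓝 x) := by
  rw [Metric.tendsto_nhds]
  intro ε hε
  have hlim : Tendsto (fun R : ℕ => Real.exp (-(R : ℝ))) atTop (𝓝 0) :=
    Real.tendsto_exp_neg_atTop_nhds_zero.comp tendsto_natCast_atTop_atTop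
  obtain ⟨R, hR⟩ := (hlim.eventually_lt_const hε).exists
  filter_upwards [(FreeGroup.finite_norm_le (α := Fin k) R).eventually_all.mpr
    fun w _ => h w] with n hn
  exact (dist_le_of_agree fun w hw => hn w hw).trans_lt hR

theorem theorem4p5 :
    (∀ n : ℕ, ∃ hgen : Subgroup.closure
        (Set.range ![ThompsonF.x₀, ThompsonF.x₁, ThompsonF.x₀ ^ n]) = ⊤,
      MarkedGroupSpace.mk ![ThompsonF.x₀, ThompsonF.x₁, ThompsonF.x₀ ^ n] hgen =
        ThompsonLimit.presented (ThompsonLimit.relsG n)) ∧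
    Tendsto (fun n : ℕ => ThompsonLimit.presented (ThompsonLimit.relsG n)) atTop
      (𝓝 (ThompsonLimit.presented ThompsonLimit.relsLimit)) := by
  refine ⟨fun n => ⟨?_, ?_⟩, ?_⟩
  · rw [eq_top_iff, ← ThompsonF.closure_x₀_x₁]
    apply Subgroup.closure_mono
    rintro x (rfl | rfl)
    exacts [⟨0, rfl⟩, ⟨1, rfl⟩]
  · apply MarkedGroupSpace.ext_relations
    rw [ThompsonLimit.relations_presented, ← ThompsonLimit.ker_toF]
    rfl
  · apply MarkedGroupSpace.tendsto_of_eventually_mem_iff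
    intro w
    simp only [ThompsonLimit.relations_presented]
    exact ThompsonLimit.eventually_mem_iff w
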